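/- Let $\Gamma$ be a group of isometries of $\mathbb R^n$ ($n\ge 0$) whose translations $x\mapsto x+v$, $v\in\mathcal T$, form a lattice $\mathcal T$ of rank $n$ in $\mathbb R^n$, and in which only the identity has a fixed point. Its point group $G\cong\Gamma/\mathcal T$ is the group of the linear parts $\mathbf M$ of the elements $x\mapsto \mathbf Mx+b$ of $\Gamma$, and $M=\mathbb R^n/\Gamma=T/G$, where $T=\mathbb R^n/\mathcal T$, is a closed flat manifold. The Laplace spectrum of $M$ is the multiset of the real numbers $\mu$ for which $-\Delta f=\mu f$ has a smooth solution $f\neq 0$, $f:M\to\mathbb C$, each taken with multiplicity the dimension of the space of solutions. Represent each element of $G$ by some $\gamma\in\Gamma$, $\gamma:x\mapsto \mathbf Mx+b$, with that linear part $\mathbf M$. Let $V_{\mathbf M}$ be the fixed space of $\mathbf M$, let $n_\gamma=\dim V_{\mathbf M}$, and let $\mathcal T_\gamma$ be the image of $\gamma(\mathcal T)$ under the orthogonal projection onto $V_{\mathbf M}$, a translate of a lattice in $V_{\mathbf M}$. Let $\mathrm{vol}(\mathcal T_\gamma)$ be the volume of the torus obtained by dividing $V_{\mathbf M}$ by that lattice,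 and put $\theta_{\mathcal T_\gamma}(q)=\sum_{v\in\mathcal T_\gamma}q^{\langle v,v\rangle}$ for $0<q<1$. Then $G$ is finite, all multiplicities in the Laplace spectrum are finite, the theta series converge, and for every $t>0$ and every choice of the representatives $$\sum_{\mu}e^{-\mu t}=\frac1{|G|}\sum_{\gamma\in G}\frac{\mathrm{vol}(\mathcal T_\gamma)}{(4\pi t)^{n_\gamma/2}}\,\theta_{\mathcal T_\gamma}\!\left(e^{-1/(4t)}\right),$$ where $\mu$ runs over the Laplace spectrum of $M$ with multiplicities and the series on the left converges. Moreover the audible data are exactly $|G|$ and the $d$-sums: two such manifolds (of possibly different dimensions) have the same Laplace spectrum, with multiplicities, if and only if their point groups have the same order and, for every integer $d\ge 0$, their $d$-sums $\sum_{\gamma\in G,\;n_\gamma=d}\mathrm{vol}(\mathcal T_\gamma)\,\theta_{\mathcal T_\gamma}(q)$ agree for all $0<q<1$. -/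

import Mathlib

open scoped ContDiff

noncomputable section

namespace FlatManifold

/-- Euclidean `n`-space. -/
abbrev Euc (n : ℕ) : Type := EuclideanSpace ℝ (Fin n)

/-- The group of isometries `x ↦ M x + b` of Euclidean `n`-space. -/
abbrev Isom (n : ℕ) : Type := Euc n ≃ᵃⁱ[ℝ] Euc n

/-- The homomorphism sending `x ↦ M x + b` to its linear part `M`. -/
def linearPart (n : ℕ) : Isom n →* (Euc n ≃ₗᵢ[ℝ] Euc n) where
  toFun γ := γ.linearIsometryEquiv
  map_one' := rfl
  map_mul' _ _ := rfl

variable {n : ℕ}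

theorem constVAdd_comp (v w : Euc n) :
    AffineIsometryEquiv.constVAdd ℝ (Euc n) (v + w) =
      AffineIsometryEquiv.constVAdd ℝ (Euc n) v * AffineIsometryEquiv.constVAdd ℝ (Euc n) w := by
  ext1 x
  simp [add_assoc]

/-- The translation lattice `𝒯` of `Γ`: all vectors `v` such that `x ↦ v + x` belongs to `Γ`. -/
def translationLattice (Γ : Subgroup (Isom n)) : Submodule ℤ (Euc n) :=
  AddSubgroup.toIntSubmodule
    { carrier := {v | AffineIsometryEquiv.constVAdd ℝ (Euc n) v ∈ Γ}
      zero_mem' := by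
        have h : AffineIsometryEquiv.constVAdd ℝ (Euc n) (0 : Euc n) = 1 :=
          AffineIsometryEquiv.constVAdd_zero
        simp only [Set.mem_ofPred_eq, h]
        exact Γ.one_mem
      add_mem' := by
        intro v w hv hw
        simp only [Set.mem_ofPred_eq, constVAdd_comp] at *
        exact Γ.mul_mem hv hw
      neg_mem' := by
        intro v hv
        have h : AffineIsometryEquiv.constVAdd ℝ (Euc n) (-v) =
            (AffineIsometryEquiv.constVAdd ℝ (Euc n) v)⁻¹ := by
          rw [eq_inv_iff_mul_eq_one, ← constVAdd_comp, neg_add_cancel]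
          exact AffineIsometryEquiv.constVAdd_zero
        simp only [Set.mem_ofPred_eq, h] at *
        exact Γ.inv_mem hv }

/-- The point group `G` of `Γ`: all linear parts `M` of elements `x ↦ M x + b` of `Γ`.
It is isomorphic to `Γ / 𝒯`. -/
def pointGroup (Γ : Subgroup (Isom n)) : Subgroup (Euc n ≃ₗᵢ[ℝ] Euc n) :=
  Γ.map (linearPart n)

/-- `Γ` is the space group of a closed flat manifold `ℝⁿ / Γ = T / G`: its translations form a
lattice of full rank, so that `T = ℝⁿ / 𝒯` is a torus, and only the identity has a fixed point. -/
structure IsFlatSpaceGroup (Γ : Subgroup (Isom n)) : Prop where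
  discrete : DiscreteTopology (translationLattice Γ)
  span_top : Submodule.span ℝ (translationLattice Γ : Set (Euc n)) = ⊤
  free : ∀ γ ∈ Γ, ∀ x : Euc n, γ x = x → γ = 1

/-- The orbit equivalence relation of `Γ` on `ℝⁿ`. -/
def orbitSetoid (Γ : Subgroup (Isom n)) : Setoid (Euc n) where
  r x y := ∃ γ ∈ Γ, γ x = y
  iseqv :=
    { refl := fun x => ⟨1, Γ.one_mem, rfl⟩
      symm := by
        rintro x y ⟨γ, hγ, rfl⟩
        exact ⟨γ⁻¹, Γ.inv_mem hγ, γ.symm_apply_apply x⟩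
      trans := by
        rintro x y z ⟨γ, hγ, rfl⟩ ⟨δ, hδ, rfl⟩
        exact ⟨δ * γ, Γ.mul_mem hδ hγ, rfl⟩ }

/-- The flat manifold `M = ℝⁿ / Γ`. -/
def Manifold (Γ : Subgroup (Isom n)) : Type := Quotient (orbitSetoid Γ)

/-- The universal covering `ℝⁿ → M`, a local isometry. -/
def proj (Γ : Subgroup (Isom n)) (x : Euc n) : Manifold Γ := Quotient.mk (orbitSetoid Γ) x

/-- The eigenspace of the Laplacian of `M` for the eigenvalue `μ` (with the sign convention
`- Δ f = μ f`). As the universal covering is a local isometry, `f : M → ℂ` is smooth with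
`- Δ f = μ f` if and only if its pull-back to `ℝⁿ` is. -/
def eigenspace (Γ : Subgroup (Isom n)) (μ : ℝ) : Submodule ℂ (Manifold Γ → ℂ) where
  carrier := {f | ContDiff ℝ ∞ (f ∘ proj Γ) ∧
    ∀ x : Euc n, -(Laplacian.laplacian (f ∘ proj Γ) x) = (μ : ℂ) * f (proj Γ x)}
  zero_mem' := by
    have h : (0 : Manifold Γ → ℂ) ∘ proj Γ = fun _ => (0 : ℂ) := rfl
    refine ⟨by rw [h]; exact contDiff_const, fun x => ?_⟩
    rw [h, InnerProductSpace.laplacian_const]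
    simp
  add_mem' := by
    rintro f g ⟨hf, hf'⟩ ⟨hg, hg'⟩
    have h : (f + g) ∘ proj Γ = f ∘ proj Γ + g ∘ proj Γ := rfl
    refine ⟨by rw [h]; exact hf.add hg, fun x => ?_⟩
    rw [h, ContDiffAt.laplacian_add (hf.contDiffAt.of_le (by norm_cast))
      (hg.contDiffAt.of_le (by norm_cast)), neg_add, hf', hg', Pi.add_apply, mul_add]
  smul_mem' := by
    rintro c f ⟨hf, hf'⟩
    have h : (c • f) ∘ proj Γ = c • (f ∘ proj Γ) := rfl
    refine ⟨by rw [h]; exact hf.const_smul c, fun x => ?_⟩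
    have h3 := ContDiffAt.laplacian_CLM_comp_left
      (l := ContinuousLinearMap.restrictScalars ℝ (c • ContinuousLinearMap.id ℂ ℂ))
      (hf.contDiffAt.of_le (by norm_cast) : ContDiffAt ℝ 2 (f ∘ proj Γ) x)
    have h4 : (c • (f ∘ proj Γ)) =
      (ContinuousLinearMap.restrictScalars ℝ (c • ContinuousLinearMap.id ℂ ℂ)) ∘ (f ∘ proj Γ) := rfl
    rw [h, h4, h3]
    have h5 := hf' x
    simp only [Function.comp_apply, ContinuousLinearMap.coe_restrictScalars',
      smul_apply, ContinuousLinearMap.id_apply, Pi.smul_apply, smul_eq_mul]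
    linear_combination c * h5

/-- The multiplicity of `μ` in the Laplace spectrum of `M` (zero if `μ` is not an eigenvalue). -/
def multiplicity (Γ : Subgroup (Isom n)) (μ : ℝ) : ℕ := Module.finrank ℂ (eigenspace Γ μ)

/-- The two manifolds have the same Laplace spectrum, as multisets. -/
def Isospectral {n m : ℕ} (Γ : Subgroup (Isom n)) (Γ' : Subgroup (Isom m)) : Prop :=
  ∀ μ : ℝ, multiplicity Γ μ = multiplicity Γ' μ

/-- The fixed space `V_M` of the orthogonal transformation `M`. -/
def fixedSpace (M : Euc n ≃ₗᵢ[ℝ] Euc n) : Submodule ℝ (Euc n) :=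
  LinearMap.eqLocus M.toLinearEquiv.toLinearMap LinearMap.id

/-- For `γ : x ↦ M x + b`, the dimension `n_γ` of `V_M`. -/
def fixedDim (γ : Isom n) : ℕ := Module.finrank ℝ (fixedSpace (linearPart n γ))

/-- For `γ : x ↦ M x + b`, the shifted lattice `𝒯_γ`: the orthogonal projection onto `V_M` of
the image `γ(𝒯)` of the translation lattice. -/
def shiftedLattice (Γ : Subgroup (Isom n)) (γ : Isom n) : Set (fixedSpace (linearPart n γ)) :=
  (fixedSpace (linearPart n γ)).orthogonalProjectionOnto '' (γ '' (translationLattice Γ : Set (Euc n)))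

/-- The lattice in `W` generated by the differences of elements of `S`; if `S` is a translate of
a lattice `L`, this is `L`. -/
def differenceLattice {W : Type*} [AddCommGroup W] (S : Set W) : Submodule ℤ W :=
  Submodule.span ℤ {w | ∃ x ∈ S, ∃ y ∈ S, w = x - y}

/-- The volume of a lattice, or of a translate of one, in a Euclidean space `W`: the volume of
the torus `W / L`, where `L` is the lattice of which `S` is a translate. -/
def latticeVol {W : Type*} [NormedAddCommGroup W] [InnerProductSpace ℝ W] [FiniteDimensional ℝ W]
    [MeasurableSpace W] [BorelSpace W] (S : Set W) : ℝ :=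
  ZLattice.covolume (differenceLattice S) (MeasureTheory.volume : MeasureTheory.Measure W)

/-- The theta function `θ_S(q) = ∑ q ^ N(v)` over `v ∈ S`, where `N(v) = ⟨v, v⟩`. -/
def theta {W : Type*} [NormedAddCommGroup W] [InnerProductSpace ℝ W] (S : Set W) (q : ℝ) : ℝ :=
  ∑' v : S, q ^ (inner ℝ (v : W) (v : W))

/-- `r` selects, for each `M` in the point group, an element `x ↦ M x + b` of `Γ`. -/
def IsRepresentativeSystem (Γ : Subgroup (Isom n)) (r : pointGroup Γ → Isom n) : Prop :=
  ∀ M : pointGroup Γ, r M ∈ Γ ∧ linearPart n (r M) = M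

/-- The `d`-sum of `M`: the sum of `vol(𝒯_γ) θ_{𝒯_γ}(q)` over the `γ` in the point group
(represented by `r`) such that `n_γ = d`. -/
def dSum (Γ : Subgroup (Isom n)) (r : pointGroup Γ → Isom n) (d : ℕ) (q : ℝ) : ℝ :=
  ∑ᶠ (M : pointGroup Γ) (_ : fixedDim (r M) = d),
    latticeVol (shiftedLattice Γ (r M)) * theta (shiftedLattice Γ (r M)) q

end FlatManifold

end

/-! Functions on M are the Γ-invariant functions on ℝⁿ, so each Laplace eigenspace of M is the
Γ-invariant part of an eigenspace of the torus T. Fourier analysis on T shows that the latter has as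
basis the plane waves exp(2πi⟨ξ,x⟩) with ξ in the dual lattice 𝒯* and 4π²‖ξ‖² = μ
(`mem_span_planeWave_of_laplacian_eq`, `linearIndependent_planeWave`). Averaging over G projects
onto the invariants, so the multiplicity of μ is the trace of this average (`multiplicity_eq_sum`).
Composition with γ : x ↦ Mx + b turns the wave of ξ into a phase times the wave of M⁻¹ξ; hence only
the ξ fixed by M contribute to the trace, each with exp(2πi⟨ξ,b⟩).

Weighted by exp(-μt) and summed over μ, the contribution of γ is a Gaussian sum over 𝒯* ∩ V_M, which
is the dual of the projection of 𝒯 to V_M. Poisson summation inside V_M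
(`tsum_gaussian_eq_tsum_dualLattice`) converts it into the theta series of the shifted lattice.
Poisson summation itself holds because both sides, as functions of the shift, are continuous and
periodic with equal Fourier coefficients.

For audibility put t = 1/(4s). The heat trace becomes |G|⁻¹ times a finite sum over d of (s/π)^(d/2)
times the d-sum, which is a Dirichlet series in s. Asymptotics as s → ∞ separate the powers and the
exponents (`eq_zero_of_sum_rpow_mul_dirichlet_eq_zero`), so the spectrum determines every d-sum
divided by |G|. The largest d with nonzero d-sum is n, which makes the dimension audible. The n-sum
comes from the identity alone; by Poisson summation it corresponds to the theta series of 𝒯*, in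
which the zero vector occurs exactly once. Comparing these constant terms gives |G|. Conversely, |G|
and the d-sums give the heat trace, a Dirichlet series whose coefficients are the multiplicities. -/

noncomputable section

namespace LatticeFourier

open MeasureTheory Filter Topology Module Complex
open scoped Pointwise FourierTransform

/-! ### Plane waves and dual lattices. -/

section PlaneWave

variable {V : Type*} [NormedAddCommGroup V] [InnerProductSpace ℝ V]

/-- The plane wave `x ↦ exp (2 π i ⟨ξ, x⟩)`. -/
def planeWave (ξ x : V) : ℂ := Complex.exp (((2 * Real.pi * inner ℝ ξ x : ℝ) : ℂ) * I)

theorem planeWave_add_right (ξ x y : V) :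
    planeWave ξ (x + y) = planeWave ξ x * planeWave ξ y := by
  simp only [planeWave, ← Complex.exp_add, inner_add_right]
  push_cast
  ring_nf

theorem planeWave_add_left (ξ η x : V) :
    planeWave (ξ + η) x = planeWave ξ x * planeWave η x := by
  simp only [planeWave, ← Complex.exp_add, inner_add_left]
  push_cast
  ring_nf

@[simp]
theorem planeWave_zero_right (ξ : V) : planeWave ξ 0 = 1 := by simp [planeWave]

@[simp]
theorem planeWave_zero_left (x : V) : planeWave 0 x = 1 := by simp [planeWave]

@[simp]
theorem norm_planeWave (ξ x : V) : ‖planeWave ξ x‖ = 1 := Complex.norm_exp_ofReal_mul_I _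

theorem planeWave_ne_zero (ξ x : V) : planeWave ξ x ≠ 0 := Complex.exp_ne_zero _

theorem exists_planeWave_eq_neg_one {ξ : V} (h0 : ξ ≠ 0) : ∃ y, planeWave ξ y = -1 := by
  -- This multiple of ξ has inner product 1/2 with ξ, so the phase is π.
  refine ⟨(2 * ‖ξ‖ ^ 2)⁻¹ • ξ, ?_⟩
  have h : (2 * Real.pi * inner ℝ ξ ((2 * ‖ξ‖ ^ 2)⁻¹ • ξ) : ℝ) = Real.pi := by
    have := norm_ne_zero_iff.2 h0
    rw [inner_smul_right, real_inner_self_eq_norm_sq]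
    field_simp
  rw [planeWave, h, Complex.exp_pi_mul_I]

theorem planeWave_linearIsometryEquiv (M : V ≃ₗᵢ[ℝ] V) (ξ x : V) :
    planeWave (M ξ) (M x) = planeWave ξ x := by
  simp only [planeWave, LinearIsometryEquiv.inner_map_map]

theorem contDiff_planeWave (ξ : V) : ContDiff ℝ ∞ (planeWave ξ) := by
  unfold planeWave
  have h : ContDiff ℝ ∞ fun x : V => ((2 * Real.pi * inner ℝ ξ x : ℝ) : ℂ) :=
    Complex.ofRealCLM.contDiff.comp (contDiff_const.mul (contDiff_const.inner ℝ contDiff_id))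
  exact (h.mul contDiff_const).cexp

theorem continuous_planeWave (ξ : V) : Continuous (planeWave ξ) :=
  (contDiff_planeWave ξ).continuous

theorem fderiv_planeWave (ξ x v : V) :
    fderiv ℝ (planeWave ξ) x v = 2 * Real.pi * inner ℝ ξ v * I * planeWave ξ x := by
  have h : HasFDerivAt (fun y : V => ((2 * Real.pi * inner ℝ ξ y : ℝ) : ℂ) * I)
      (((Complex.ofRealCLM.comp ((2 * Real.pi) • innerSL ℝ ξ)).smulRight I)) x := by
    exact ((Complex.ofRealCLM.comp ((2 * Real.pi) • innerSL ℝ ξ)).smulRight I).hasFDerivAt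
  have h2 : HasFDerivAt (planeWave ξ) _ x := h.cexp
  rw [h2.fderiv]
  simp [planeWave]
  ring

/-- The dual of a lattice: all `ξ` with integral inner products with the vectors of `L`. -/
def dualLattice (L : Submodule ℤ V) : Submodule ℤ V :=
  LinearMap.BilinForm.dualSubmodule (innerₗ V) L

theorem mem_dualLattice {L : Submodule ℤ V} {ξ : V} :
    ξ ∈ dualLattice L ↔ ∀ v ∈ L, ∃ k : ℤ, (k : ℝ) = inner ℝ ξ v := by
  simp [dualLattice, LinearMap.BilinForm.mem_dualSubmodule, Submodule.mem_one]

theorem planeWave_eq_one {L : Submodule ℤ V} {ξ v : V} (hξ : ξ ∈ dualLattice L) (hv : v ∈ L) :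
    planeWave ξ v = 1 := by
  obtain ⟨k, hk⟩ := mem_dualLattice.1 hξ v hv
  rw [planeWave, ← hk, Complex.exp_eq_one_iff]
  exact ⟨k, by push_cast; ring⟩

variable [FiniteDimensional ℝ V] (L : Submodule ℤ V) [DiscreteTopology L]

/-- Only finitely many points of a lattice lie in a ball. -/
theorem finite_norm_le (R : ℝ) : {v : V | v ∈ L ∧ ‖v‖ ≤ R}.Finite := by
  have H : IsClosed (X := V) L := @AddSubgroup.isClosed_of_discrete _ _ _ _ _
    L.toAddSubgroup (inferInstanceAs (DiscreteTopology L))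
  refine (Metric.finite_isBounded_inter_isClosed DiscreteTopology.isDiscrete
    (Metric.isBounded_closedBall (x := (0 : V)) (r := R)) H).subset ?_
  rintro v ⟨h1, h2⟩
  exact ⟨by simpa using h2, h1⟩

/-- A Gaussian is dominated by any inverse power of the distance, and inverse powers beyond the rank
of the lattice are summable. The bound comes from a single term of the exponential series; it can
fail only at the lattice point -c, if there is one. -/
theorem summable_exp_neg_mul_norm_add_sq {a : ℝ} (ha : 0 < a) (c : V) :
    Summable fun v : L => Real.exp (-a * ‖(v : V) + c‖ ^ 2) := by
  -- Any k with 2k larger than the rank would do.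
  set k := finrank ℤ L + 1
  have h := (ZLattice.summable_norm_sub_inv_pow L (2 * k) (by omega) (-c)).mul_left
    (k.factorial * a⁻¹ ^ k)
  refine h.of_norm_bounded_eventually ?_
  refine Set.Finite.subset (s := {v : L | (v : V) = -c}) ?_ ?_
  · refine Set.Subsingleton.finite ?_
    intro x hx y hy
    exact Subtype.ext (hx.trans hy.symm)
  · intro v hv
    by_contra hne
    apply hv
    change ‖Real.exp (-a * ‖(v : V) + c‖ ^ 2)‖ ≤ _ * ‖(v : V) - -c‖⁻¹ ^ (2 * k)
    have hpos : 0 < ‖(v : V) + c‖ := by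
      rw [norm_pos_iff]
      exact fun h0 => hne (eq_neg_of_add_eq_zero_left h0)
    have hu : 0 < a * ‖(v : V) + c‖ ^ 2 := by positivity
    have h1 := Real.pow_div_factorial_le_exp _ hu.le k
    simp only [sub_neg_eq_add, Real.norm_eq_abs, Real.abs_exp, neg_mul]
    rw [Real.exp_neg]
    rw [inv_le_comm₀ (Real.exp_pos _) (by positivity)]
    refine le_trans (le_of_eq ?_) h1
    have ha' := ha.ne'
    simp only [mul_pow, inv_pow, ← pow_mul]
    field_simp

variable [IsZLattice ℝ L]

/-- The basis dual to a lattice basis generates the dual lattice. In this form discreteness and full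
rank of the dual follow at once. -/
theorem dualLattice_eq_span : ∃ b : Basis (Free.ChooseBasisIndex ℤ L) ℝ V,
    dualLattice L = Submodule.span ℤ (Set.range b) := by
  classical
  have hB : LinearMap.BilinForm.Nondegenerate (innerₗ V) := by
    refine ⟨fun x hx => ?_, fun x hx => ?_⟩
    · exact inner_self_eq_zero.1 (hx x)
    · exact inner_self_eq_zero.1 (hx x)
  refine ⟨LinearMap.BilinForm.dualBasis (innerₗ V) hB
    ((Free.chooseBasis ℤ L).ofZLatticeBasis ℝ L), ?_⟩
  conv_lhs => rw [dualLattice, ← (Free.chooseBasis ℤ L).ofZLatticeBasis_span ℝ]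
  exact LinearMap.BilinForm.dualSubmodule_span_of_basis _ hB _

instance : DiscreteTopology (dualLattice L) := by
  obtain ⟨b, hb⟩ := dualLattice_eq_span L
  rw [hb]
  infer_instance

instance : IsZLattice ℝ (dualLattice L) := by
  obtain ⟨b, hb⟩ := dualLattice_eq_span L
  refine ⟨?_⟩
  rw [hb]
  exact IsZLattice.span_top

end PlaneWave

/-! ### Integration of periodic functions over a fundamental cell. -/

section Cell

variable {V : Type*} [NormedAddCommGroup V] [InnerProductSpace ℝ V] [FiniteDimensional ℝ V]
  (L : Submodule ℤ V) [DiscreteTopology L] [IsZLattice ℝ L]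

/-- A fundamental cell of a lattice. -/
def cell : Set V := ZSpan.fundamentalDomain ((Free.chooseBasis ℤ L).ofZLatticeBasis ℝ L)

variable {L} in
/-- Continuous periodic functions are bounded. -/
theorem exists_norm_le_of_periodic {E : Type*} [NormedAddCommGroup E] {f : V → E}
    (hf : Continuous f) (hper : ∀ v ∈ L, ∀ x, f (x + v) = f x) : ∃ C, ∀ x, ‖f x‖ ≤ C := by
  obtain ⟨C, hC⟩ := (IsZLattice.isCompact_range_of_periodic L f hf
    fun z w hw => hper w hw z).isBounded.exists_norm_le
  exact ⟨C, fun x => hC _ ⟨x, rfl⟩⟩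

variable [MeasurableSpace V] [BorelSpace V]

theorem isAddFundamentalDomain_cell : IsAddFundamentalDomain L (cell L) (volume : Measure V) :=
  ZLattice.isAddFundamentalDomain _ _

theorem volume_cell_lt_top : volume (cell L) < ⊤ :=
  (ZSpan.fundamentalDomain_isBounded _).measure_lt_top

instance : IsFiniteMeasure (volume.restrict (cell L)) :=
  ⟨by simpa using volume_cell_lt_top L⟩

instance : VAddInvariantMeasure L V (volume : Measure V) :=
  inferInstanceAs (VAddInvariantMeasure L.toAddSubgroup V volume)

instance : MeasurableConstVAdd L V :=
  inferInstanceAs (MeasurableConstVAdd L.toAddSubgroup V)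

theorem covolume_eq_volume_real_cell :
    ZLattice.covolume L (volume : Measure V) = (volume : Measure V).real (cell L) :=
  ZLattice.covolume_eq_measure_fundamentalDomain L volume (isAddFundamentalDomain_cell L)

variable {L}

theorem integrableOn_cell_of_periodic {E : Type*} [NormedAddCommGroup E] {f : V → E}
    (hf : Continuous f) (hper : ∀ v ∈ L, ∀ x, f (x + v) = f x) :
    IntegrableOn f (cell L) := by
  obtain ⟨C, hC⟩ := exists_norm_le_of_periodic hf hper
  have : SecondCountableTopologyEither V E := inferInstance
  exact Integrable.of_bound hf.aestronglyMeasurable C (ae_of_all _ hC)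

/-- Integrals of periodic functions over a cell are translation invariant. -/
theorem integral_cell_add_right {E : Type*} [NormedAddCommGroup E] [NormedSpace ℝ E] {f : V → E}
    (hper : ∀ v ∈ L, ∀ x, f (x + v) = f x) (y : V) :
    ∫ x in cell L, f (x + y) = ∫ x in cell L, f x := by
  have h1 : ∫ x in cell L, f (x + y) = ∫ x in y +ᵥ cell L, f x := by
    have := (measurePreserving_vadd y (volume : Measure V)).setIntegral_image_emb
      (measurableEmbedding_const_vadd y) f (cell L)
    rw [Set.image_vadd] at this
    rw [this]
    simp [add_comm]
  rw [h1]
  refine IsAddFundamentalDomain.setIntegral_eq (G := L)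
    ((isAddFundamentalDomain_cell L).vadd_of_comm y) (isAddFundamentalDomain_cell L) ?_
  intro g x
  rw [Submodule.vadd_def, vadd_eq_add, add_comm]
  exact hper g g.2 x

/-- A nontrivial periodic plane wave has mean zero. -/
theorem integral_cell_planeWave {ξ : V} (hξ : ξ ∈ dualLattice L) (h0 : ξ ≠ 0) :
    ∫ x in cell L, planeWave ξ x = 0 := by
  -- Translation by y preserves the integral but multiplies the integrand by -1.
  obtain ⟨y, hy⟩ := exists_planeWave_eq_neg_one h0
  have h := integral_cell_add_right (L := L) (f := planeWave ξ)
    (fun v hv x => by rw [planeWave_add_right, planeWave_eq_one hξ hv, mul_one]) y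
  simp only [planeWave_add_right, hy, mul_neg_one, integral_neg] at h
  linear_combination (-1 / 2 : ℂ) * h

/-- The integral of a directional derivative of a periodic function over a cell vanishes. -/
theorem integral_cell_fderiv {f : V → ℂ} (hf : ContDiff ℝ 1 f)
    (hper : ∀ v ∈ L, ∀ x, f (x + v) = f x) (w : V) :
    ∫ x in cell L, fderiv ℝ f x w = 0 := by
  have hc : Continuous fun x => fderiv ℝ f x w :=
    (hf.continuous_fderiv one_ne_zero).clm_apply continuous_const
  have hper' : ∀ v ∈ L, ∀ x, fderiv ℝ f (x + v) w = fderiv ℝ f x w := by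
    intro v hv x
    rw [← fderiv_comp_add_right, funext (hper v hv)]
  obtain ⟨C, hC⟩ := exists_norm_le_of_periodic hc hper'
  have hshift : ∀ s : ℝ, Continuous fun x => f (x + s • w) := fun s =>
    hf.continuous.comp (by fun_prop)
  -- The integral of f(x + sw) does not depend on s; differentiating under the integral sign at s =
  -- 0 gives the claim.
  have h := (hasDerivAt_integral_of_dominated_loc_of_deriv_le (μ := volume.restrict (cell L))
    (F := fun (s : ℝ) x => f (x + s • w)) (F' := fun (s : ℝ) x => fderiv ℝ f (x + s • w) w)
    (x₀ := 0) (bound := fun _ => C) univ_mem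
    (Eventually.of_forall fun s => (hshift s).aestronglyMeasurable) ?_ ?_ ?_ ?_ ?_).2
  · have h2 : (fun s : ℝ => ∫ x in cell L, f (x + s • w)) = fun _ => ∫ x in cell L, f x :=
      funext fun s => integral_cell_add_right hper _
    rw [h2] at h
    have := h.unique (hasDerivAt_const 0 _)
    simpa using this
  · simp only [zero_smul, add_zero]
    exact integrableOn_cell_of_periodic hf.continuous hper
  · simpa using hc.aestronglyMeasurable
  · exact ae_of_all _ fun x s _ => hC _
  · exact integrable_const C
  · refine ae_of_all _ fun x s _ => ?_
    have h1 : HasFDerivAt f (fderiv ℝ f (x + s • w)) (x + s • w) :=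
      (hf.differentiable one_ne_zero _).hasFDerivAt
    have h2 : HasDerivAt (fun s : ℝ => x + s • w) w s := by
      simpa using ((hasDerivAt_id s).smul_const w).const_add x
    exact h1.comp_hasDerivAt s h2

/-- Fourier coefficients of a directional derivative. -/
theorem integral_cell_fderiv_mul_planeWave {f : V → ℂ} (hf : ContDiff ℝ 1 f)
    (hper : ∀ v ∈ L, ∀ x, f (x + v) = f x) {ξ : V} (hξ : ξ ∈ dualLattice L) (w : V) :
    ∫ x in cell L, fderiv ℝ f x w * planeWave (-ξ) x =
      2 * Real.pi * inner ℝ ξ w * I * ∫ x in cell L, f x * planeWave (-ξ) x := by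
  have hp : ContDiff ℝ 1 (planeWave (-ξ)) := (contDiff_planeWave _).of_le (by norm_cast)
  have hpp : ∀ v ∈ L, ∀ x, planeWave (-ξ) (x + v) = planeWave (-ξ) x := fun v hv x => by
    rw [planeWave_add_right, planeWave_eq_one (neg_mem hξ) hv, mul_one]
  have h := integral_cell_fderiv (hf.mul hp) (fun v hv x => by rw [hper v hv, hpp v hv]) w
  -- Integration by parts: the derivative of the product has integral zero.
  have hd : ∀ x, fderiv ℝ (fun x => f x * planeWave (-ξ) x) x w =
      fderiv ℝ f x w * planeWave (-ξ) x -
        2 * Real.pi * inner ℝ ξ w * I * (f x * planeWave (-ξ) x) := by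
    intro x
    rw [fderiv_fun_mul (hf.differentiable one_ne_zero x) (hp.differentiable one_ne_zero x)]
    simp only [add_apply, smul_apply, fderiv_planeWave, smul_eq_mul, inner_neg_left]
    push_cast
    ring
  simp only [hd] at h
  have hc : Continuous fun x => fderiv ℝ f x w :=
    (hf.continuous_fderiv one_ne_zero).clm_apply continuous_const
  have hper' : ∀ v ∈ L, ∀ x, fderiv ℝ f (x + v) w = fderiv ℝ f x w := by
    intro v hv x
    rw [← fderiv_comp_add_right, funext (hper v hv)]
  have hi1 : Integrable (fun x => fderiv ℝ f x w * planeWave (-ξ) x) (volume.restrict (cell L)) :=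
    integrableOn_cell_of_periodic (hc.mul hp.continuous) fun v hv x => by
      simp only [hper' v hv, hpp v hv]
  have hi2 : Integrable (fun x => f x * planeWave (-ξ) x) (volume.restrict (cell L)) :=
    integrableOn_cell_of_periodic (hf.continuous.mul hp.continuous) fun v hv x => by
      simp only [hper v hv, hpp v hv]
  rw [integral_sub hi1 (hi2.const_mul _), integral_const_mul] at h
  exact sub_eq_zero.1 h

end Cell

/-! ### Uniqueness of Fourier coefficients, by transfer to the standard torus. -/

section Uniqueness

variable {V : Type*} [NormedAddCommGroup V] [InnerProductSpace ℝ V] [FiniteDimensional ℝ V]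
  {L : Submodule ℤ V} [DiscreteTopology L] [IsZLattice ℝ L] [MeasurableSpace V] [BorelSpace V]

theorem isOpenQuotientMap_mk_unitAddTorus (ι : Type*) :
    IsOpenQuotientMap (fun (x : ι → ℝ) (i : ι) => (x i : UnitAddCircle)) :=
  IsOpenQuotientMap.piMap fun _ => QuotientAddGroup.isOpenQuotientMap_mk

/-- The integral over a unit cube in coordinates with respect to a lattice basis is a multiple of
the integral over a cell. -/
theorem exists_integral_cube_eq (L : Submodule ℤ V) [DiscreteTopology L] [IsZLattice ℝ L] :
    ∃ c : ℝ, ∀ φ : V → ℂ,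
      ∫ x in {x : Free.ChooseBasisIndex ℤ L → ℝ | ∀ i, x i ∈ Set.Ioc (0 : ℝ) (0 + 1)},
        φ (((Free.chooseBasis ℤ L).ofZLatticeBasis ℝ L).equivFun.symm x) =
      c * ∫ x in cell L, φ x := by
  set B := (Free.chooseBasis ℤ L).ofZLatticeBasis ℝ L
  set e : (Free.ChooseBasisIndex ℤ L → ℝ) ≃L[ℝ] V := B.equivFunL.symm
  -- By uniqueness of Haar measure the coordinate change scales volume by a constant, whose value is
  -- irrelevant here.
  have : (Measure.map e volume).IsAddHaarMeasure :=
    e.isAddHaarMeasure_map volume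
  have hc := Measure.isAddLeftInvariant_eq_smul (Measure.map e volume) (volume : Measure V)
  set c := Measure.addHaarScalarFactor (Measure.map e volume) (volume : Measure V)
  refine ⟨c, fun φ => ?_⟩
  -- The two cubes are half-open at opposite ends and differ by a null set.
  have h1 : ({x : Free.ChooseBasisIndex ℤ L → ℝ | ∀ i, x i ∈ Set.Ioc (0 : ℝ) (0 + 1)} : Set _)
      =ᵐ[volume] e ⁻¹' (cell L) := by
    have h2 : e ⁻¹' (cell L) = Set.univ.pi fun _ => Set.Ico (0 : ℝ) 1 := by
      ext x
      have : ∀ i, B.repr (e x) i = x i := fun i =>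
        congrFun (B.equivFun.apply_symm_apply x) i
      change (∀ i, B.repr (e x) i ∈ Set.Ico (0 : ℝ) 1) ↔ _
      simp [this]
    have h3 : {x : Free.ChooseBasisIndex ℤ L → ℝ | ∀ i, x i ∈ Set.Ioc (0 : ℝ) (0 + 1)} =
        Set.univ.pi fun _ => Set.Ioc (0 : ℝ) 1 := by
      ext x
      simp
    rw [h2, h3, volume_pi]
    exact (Measure.univ_pi_Ioc_ae_eq_Icc).trans (Measure.univ_pi_Ico_ae_eq_Icc).symm
  rw [setIntegral_congr_set h1]
  have h4 := setIntegral_map_equiv (μ := volume) e.toHomeomorph.toMeasurableEquiv φ (cell L)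
  change ∫ x in cell L, φ x ∂(Measure.map e volume) = ∫ x in e ⁻¹' (cell L), φ (e x) at h4
  rw [hc, Measure.restrict_smul, integral_smul_nnreal_measure] at h4
  change ∫ x in e ⁻¹' (cell L), φ (e x) = _
  rw [← h4, NNReal.smul_def, Complex.real_smul]

/-- A continuous periodic function all of whose Fourier coefficients vanish is zero. -/
theorem eq_zero_of_integral_cell_mul_planeWave_eq_zero {f : V → ℂ} (hf : Continuous f)
    (hper : ∀ v ∈ L, ∀ x, f (x + v) = f x)
    (h : ∀ ξ ∈ dualLattice L, ∫ x in cell L, f x * planeWave (-ξ) x = 0) (x : V) : f x = 0 := by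
  classical
  set B := (Free.chooseBasis ℤ L).ofZLatticeBasis ℝ L with hB
  set e : (Free.ChooseBasisIndex ℤ L → ℝ) ≃L[ℝ] V := B.equivFunL.symm with he
  set q := fun (x : Free.ChooseBasisIndex ℤ L → ℝ) (i : Free.ChooseBasisIndex ℤ L) =>
    (x i : UnitAddCircle) with hq
  have hq' : IsOpenQuotientMap q := isOpenQuotientMap_mk_unitAddTorus _
  -- Coordinates that agree modulo 1 differ by a lattice vector, so periodicity lets f descend to
  -- the torus.
  have hfac : Function.FactorsThrough (fun x => f (e x)) q := by
    intro a b hab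
    have h1 : ∀ i, ∃ k : ℤ, a i = b i + k := by
      intro i
      have := congrFun hab i
      simp only [hq] at this
      rw [← sub_eq_zero, ← AddCircle.coe_sub, AddCircle.coe_eq_zero_iff] at this
      obtain ⟨k, hk⟩ := this
      refine ⟨k, ?_⟩
      rw [zsmul_one] at hk
      linarith
    choose k hk using h1
    have h2 : e a = e b + ∑ i, k i • B i := by
      have : a = b + fun i => (k i : ℝ) := funext hk
      rw [this, map_add]
      congr 1
      change B.equivFun.symm (fun i => (k i : ℝ)) = _
      simp only [Basis.equivFun_symm_apply, Int.cast_smul_eq_zsmul]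
    simp only [h2]
    refine hper _ (sum_mem fun i _ => L.smul_mem _ ?_) _
    rw [hB, Basis.ofZLatticeBasis_apply]
    exact Subtype.mem _
  have hF₀ : ∀ x, f (e (Function.surjInv hq'.surjective (q x))) = f (e x) := fun x =>
    hfac (Function.surjInv_eq hq'.surjective (q x))
  let F : C(UnitAddTorus (Free.ChooseBasisIndex ℤ L), ℂ) :=
    ⟨fun y => f (e (Function.surjInv hq'.surjective y)), by
      rw [hq'.isQuotientMap.continuous_iff]
      exact (hf.comp e.continuous).congr fun x => (hF₀ x).symm⟩
  have hF : ∀ x, F (q x) = f (e x) := hF₀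
  obtain ⟨c, hc⟩ := exists_integral_cube_eq L
  have hcoef : UnitAddTorus.mFourierCoeff F = 0 := by
    funext n
    rw [UnitAddTorus.mFourierCoeff_eq_integral F n 0]
    -- The torus character with index n is the plane wave of the dual vector whose inner products
    -- with the basis are the entries of n.
    obtain ⟨ξ, hξ⟩ : ∃ ξ : V, ∀ i, inner ℝ ξ (B i) = (n i : ℝ) := by
      refine ⟨(InnerProductSpace.toDual ℝ V).symm
        (LinearMap.toContinuousLinearMap (B.constr ℝ fun i => (n i : ℝ))), fun i => ?_⟩
      rw [InnerProductSpace.toDual_symm_apply]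
      simp
    have hξ' : ∀ x, inner ℝ ξ (e x) = ∑ i, x i * n i := by
      intro x
      have : e x = ∑ i, x i • B i := B.equivFun_symm_apply x
      simp [this, inner_sum, inner_smul_right, hξ]
    have hmem : ξ ∈ dualLattice L := by
      rw [mem_dualLattice]
      intro v hv
      refine ⟨∑ i, (Free.chooseBasis ℤ L).repr ⟨v, hv⟩ i * n i, ?_⟩
      have h1 := (Free.chooseBasis ℤ L).sum_repr ⟨v, hv⟩
      have h2 : v = ∑ i, (Free.chooseBasis ℤ L).repr ⟨v, hv⟩ i • B i := by
        have h3 := congrArg (Subtype.val : L → V) h1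
        rw [AddSubmonoidClass.coe_finsetSum] at h3
        refine h3.symm.trans (Finset.sum_congr rfl fun i _ => ?_)
        rw [hB, Basis.ofZLatticeBasis_apply]
        rfl
      conv_rhs => rw [h2]
      simp only [← Int.cast_smul_eq_zsmul ℝ, inner_sum, inner_smul_right, hξ]
      push_cast
      rfl
    have h3 := hc fun y => f y * planeWave (-ξ) y
    rw [h ξ hmem, mul_zero] at h3
    refine Eq.trans ?_ h3
    congr 1
    funext x
    change UnitAddTorus.mFourier (-n) (q x) • F (q x) = f (e x) * planeWave (-ξ) (e x)
    rw [hF, smul_eq_mul, mul_comm]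
    congr 1
    simp only [UnitAddTorus.mFourier, ContinuousMap.coe_mk, hq, fourier_coe_apply, planeWave,
      inner_neg_left, hξ', ← Complex.exp_sum, Pi.neg_apply]
    congr 1
    push_cast
    rw [← Finset.sum_neg_distrib, Finset.mul_sum, Finset.sum_mul]
    refine Finset.sum_congr rfl fun i _ => ?_
    ring
  -- Vanishing coefficients are summable, so the Fourier series converges pointwise to F, while its
  -- sum is zero.
  have hs := UnitAddTorus.hasSum_mFourier_series_apply_of_summable (f := F)
    (by rw [hcoef]; exact summable_zero) (q (e.symm x))
  rw [hF, ContinuousLinearEquiv.apply_symm_apply, hcoef] at hs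
  simp only [Pi.zero_apply, zero_smul] at hs
  exact hs.unique hasSum_zero

end Uniqueness

/-! ### Poisson summation for Gaussians. -/

section Poisson

/-- Since ‖v‖² ≤ 2‖v + x‖² + 2R², halving the exponent buys a bound uniform in x on a ball. It
supplies the dominating series both for continuity of the periodized Gaussian and for exchanging sum
and integral. -/
theorem exp_neg_mul_norm_add_sq_le {V : Type*} [SeminormedAddCommGroup V] {a R : ℝ}
    (ha : 0 < a) (v : V) {x : V} (hx : ‖x‖ ≤ R) :
    Real.exp (-a * ‖v + x‖ ^ 2) ≤ Real.exp (a * R ^ 2) * Real.exp (-(a / 2) * ‖v + 0‖ ^ 2) := by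
  rw [← Real.exp_add, Real.exp_le_exp, add_zero]
  have h1 : ‖v‖ ≤ ‖v + x‖ + ‖x‖ := by simpa using norm_sub_le (v + x) x
  have h2 : ‖v‖ ^ 2 ≤ 2 * ‖v + x‖ ^ 2 + 2 * R ^ 2 := by
    have h3 : ‖v‖ ^ 2 ≤ (‖v + x‖ + R) ^ 2 := by gcongr; linarith
    nlinarith [sq_nonneg (‖v + x‖ - R)]
  nlinarith

variable {V : Type*} [NormedAddCommGroup V] (L : Submodule ℤ V)

/-- The sum of a Gaussian over the translates by lattice vectors. -/
def periodizedGaussian (a : ℝ) (x : V) : ℂ := ∑' v : L, (Real.exp (-a * ‖(v : V) + x‖ ^ 2) : ℂ)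

theorem periodizedGaussian_add {a : ℝ} {w : V} (hw : w ∈ L) (x : V) :
    periodizedGaussian L a (x + w) = periodizedGaussian L a x := by
  refine Eq.trans (tsum_congr fun v => ?_) ((Equiv.addRight (⟨w, hw⟩ : L)).tsum_eq
    fun v : L => (Real.exp (-a * ‖(v : V) + x‖ ^ 2) : ℂ))
  rw [Equiv.coe_addRight, Submodule.coe_add, add_assoc, add_comm x w]

variable [InnerProductSpace ℝ V] [FiniteDimensional ℝ V] [DiscreteTopology L]

theorem continuous_periodizedGaussian {a : ℝ} (ha : 0 < a) :
    Continuous (periodizedGaussian L a) := by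
  rw [continuous_iff_continuousAt]
  intro x
  have h : ContinuousOn (periodizedGaussian L a) (Metric.ball 0 (‖x‖ + 1)) := by
    refine continuousOn_tsum (fun v => ?_)
      ((summable_exp_neg_mul_norm_add_sq L (half_pos ha) 0).mul_left
        (Real.exp (a * (‖x‖ + 1) ^ 2))) fun v y hy => ?_
    · fun_prop
    · rw [Complex.norm_real, Real.norm_eq_abs, Real.abs_exp]
      exact exp_neg_mul_norm_add_sq_le ha _ (by simpa using (Metric.mem_ball.1 hy).le)
  exact h.continuousAt (Metric.isOpen_ball.mem_nhds (by simp))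

variable [IsZLattice ℝ L] [MeasurableSpace V] [BorelSpace V]

theorem integral_gaussian_mul_planeWave {a : ℝ} (ha : 0 < a) (ξ : V) :
    ∫ x : V, (Real.exp (-a * ‖x‖ ^ 2) : ℂ) * planeWave (-ξ) x =
      ((Real.pi / a) ^ ((finrank ℝ V : ℝ) / 2) : ℝ) * Real.exp (-Real.pi ^ 2 * ‖ξ‖ ^ 2 / a) := by
  have h := fourier_gaussian_innerProductSpace (V := V) (b := a) (by simpa using ha) ξ
  rw [Real.fourier_eq'] at h
  convert h using 1
  · congr 1
    funext x
    rw [smul_eq_mul, mul_comm, planeWave, inner_neg_left, real_inner_comm]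
    push_cast
    ring_nf
  · rw [Complex.ofReal_cpow (by positivity)]
    push_cast
    ring_nf

/-- The Fourier coefficients of the periodized Gaussian. -/
theorem integral_cell_periodizedGaussian {a : ℝ} (ha : 0 < a) {ξ : V} (hξ : ξ ∈ dualLattice L) :
    ∫ x in cell L, periodizedGaussian L a x * planeWave (-ξ) x =
      ((Real.pi / a) ^ ((finrank ℝ V : ℝ) / 2) : ℝ) * Real.exp (-Real.pi ^ 2 * ‖ξ‖ ^ 2 / a) := by
  rw [← integral_gaussian_mul_planeWave ha]
  have hint : Integrable fun x : V => (Real.exp (-a * ‖x‖ ^ 2) : ℂ) * planeWave (-ξ) x := by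
    have h := GaussianFourier.integrable_cexp_neg_mul_sq_norm_add (V := V) (b := a)
      (by simpa using ha) 0 0
    refine (h.mul_bdd (c := 1) (continuous_planeWave (-ξ)).aestronglyMeasurable
      (ae_of_all _ fun x => by simp)).congr (ae_of_all _ fun x => ?_)
    simp
  -- Unfolding: the integral over the whole space is the sum of the integrals over the translates of
  -- the cell, and the wave is lattice-periodic.
  rw [(isAddFundamentalDomain_cell L).integral_eq_tsum'' _ hint]
  have hper : ∀ (v : L) (x : V), (Real.exp (-a * ‖v +ᵥ x‖ ^ 2) : ℂ) * planeWave (-ξ) (v +ᵥ x) =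
      (Real.exp (-a * ‖(v : V) + x‖ ^ 2) : ℂ) * planeWave (-ξ) x := by
    intro v x
    rw [Submodule.vadd_def, vadd_eq_add, planeWave_add_right,
      planeWave_eq_one (neg_mem hξ) v.2, one_mul]
  simp only [hper]
  obtain ⟨R, hR⟩ := (ZSpan.fundamentalDomain_isBounded
    ((Free.chooseBasis ℤ L).ofZLatticeBasis ℝ L)).exists_norm_le
  have hcont : ∀ v : L, Continuous fun x : V =>
      (Real.exp (-a * ‖(v : V) + x‖ ^ 2) : ℂ) * planeWave (-ξ) x := fun v =>
    Continuous.mul (by fun_prop) (continuous_planeWave _)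
  have hbound : ∀ v : L, ∀ᵐ x ∂(volume.restrict (cell L)),
      ‖(Real.exp (-a * ‖(v : V) + x‖ ^ 2) : ℂ) * planeWave (-ξ) x‖ ≤
        Real.exp (a * R ^ 2) * Real.exp (-(a / 2) * ‖(v : V) + 0‖ ^ 2) := by
    intro v
    refine ae_restrict_of_forall_mem (ZSpan.fundamentalDomain_measurableSet _) fun x hx => ?_
    rw [norm_mul, norm_planeWave, mul_one, Complex.norm_real, Real.norm_eq_abs, Real.abs_exp]
    exact exp_neg_mul_norm_add_sq_le ha _ (hR x hx)
  have hs := hasSum_integral_of_summable_integral_norm (μ := volume.restrict (cell L))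
    (F := fun (v : L) x => (Real.exp (-a * ‖(v : V) + x‖ ^ 2) : ℂ) * planeWave (-ξ) x)
    (fun v => Integrable.of_bound (hcont v).aestronglyMeasurable _ (hbound v)) ?_
  · rw [hs.tsum_eq]
    simp only [tsum_mul_right, periodizedGaussian]
  · refine Summable.of_nonneg_of_le (fun v => integral_nonneg fun x => norm_nonneg _) (fun v => ?_)
      (((summable_exp_neg_mul_norm_add_sq L (half_pos ha) 0).mul_left
        (Real.exp (a * R ^ 2))).mul_right (volume.real (cell L)))
    have h := norm_setIntegral_le_of_norm_le_const_ae (volume_cell_lt_top L)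
      (f := fun x => ‖(Real.exp (-a * ‖(v : V) + x‖ ^ 2) : ℂ) * planeWave (-ξ) x‖)
      ((hbound v).mono fun x hx => by simpa only [norm_norm] using hx)
    exact (le_abs_self _).trans h

/-- The Fourier coefficients of an absolutely convergent Gaussian Fourier series. -/
theorem integral_cell_fourierSeries {a : ℝ} (ha : 0 < a) {ξ : V} (hξ : ξ ∈ dualLattice L) :
    ∫ x in cell L, (∑' η : dualLattice L, planeWave (η : V) x *
        (Real.exp (-a * ‖(η : V)‖ ^ 2) : ℂ)) * planeWave (-ξ) x =
      ZLattice.covolume L * Real.exp (-a * ‖ξ‖ ^ 2) := by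
  classical
  have hs := hasSum_integral_of_summable_integral_norm (μ := volume.restrict (cell L))
    (F := fun (η : dualLattice L) x => planeWave ((η : V) - ξ) x *
      (Real.exp (-a * ‖(η : V)‖ ^ 2) : ℂ))
    (fun η => Integrable.of_bound
      ((continuous_planeWave _).mul continuous_const).aestronglyMeasurable
        (Real.exp (-a * ‖(η : V)‖ ^ 2)) (ae_of_all _ fun x => by
          rw [norm_mul, norm_planeWave, one_mul, Complex.norm_real, Real.norm_eq_abs,
            Real.abs_exp])) ?_
  · have h1 : ∀ η : dualLattice L, ∫ x in cell L, planeWave ((η : V) - ξ) x *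
        (Real.exp (-a * ‖(η : V)‖ ^ 2) : ℂ) =
        if η = ⟨ξ, hξ⟩ then (ZLattice.covolume L * Real.exp (-a * ‖ξ‖ ^ 2) : ℂ) else 0 := by
      intro η
      split_ifs with h
      · subst h
        simp only [sub_self, planeWave_zero_left, one_mul]
        rw [setIntegral_const, covolume_eq_volume_real_cell, Complex.real_smul]
      · rw [integral_mul_const, integral_cell_planeWave (sub_mem η.2 hξ), zero_mul]
        exact fun h0 => h (Subtype.ext (sub_eq_zero.1 h0))
    simp only [h1] at hs
    have h2 := hs.unique (hasSum_ite_eq (⟨ξ, hξ⟩ : dualLattice L) _)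
    rw [← h2]
    congr 1
    funext x
    rw [← tsum_mul_right]
    refine tsum_congr fun η => ?_
    rw [sub_eq_add_neg, planeWave_add_left]
    ring
  · have : ∀ η : dualLattice L, ∫ x in cell L, ‖planeWave ((η : V) - ξ) x *
        (Real.exp (-a * ‖(η : V)‖ ^ 2) : ℂ)‖ =
        volume.real (cell L) * Real.exp (-a * ‖(η : V) + 0‖ ^ 2) := by
      intro η
      simp only [norm_mul, norm_planeWave, one_mul, Complex.norm_real, Real.norm_eq_abs,
        Real.abs_exp, add_zero]
      rw [setIntegral_const, smul_eq_mul]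
    simp only [this]
    exact (summable_exp_neg_mul_norm_add_sq (dualLattice L) ha 0).mul_left _

/-- **Poisson summation** for Gaussians over translates of a lattice. -/
theorem tsum_gaussian_eq_tsum_dualLattice {a : ℝ} (ha : 0 < a) (c : V) :
    (ZLattice.covolume L * ∑' v : L, Real.exp (-a * ‖(v : V) + c‖ ^ 2) : ℝ) =
      ((Real.pi / a) ^ ((finrank ℝ V : ℝ) / 2) : ℝ) *
        ∑' ξ : dualLattice L, planeWave (ξ : V) c *
          (Real.exp (-(Real.pi ^ 2 / a) * ‖(ξ : V)‖ ^ 2) : ℂ) := by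
  set K : ℝ := (Real.pi / a) ^ ((finrank ℝ V : ℝ) / 2)
  set b : ℝ := Real.pi ^ 2 / a
  have hb : 0 < b := by positivity
  set H : V → ℂ := fun x => ∑' ξ : dualLattice L, planeWave (ξ : V) x *
    (Real.exp (-b * ‖(ξ : V)‖ ^ 2) : ℂ) with hH
  have hHc : Continuous H := by
    refine continuous_tsum (fun ξ => (continuous_planeWave _).mul continuous_const)
      (summable_exp_neg_mul_norm_add_sq (dualLattice L) hb 0) fun ξ x => ?_
    rw [norm_mul, norm_planeWave, one_mul, add_zero, Complex.norm_real, Real.norm_eq_abs,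
      Real.abs_exp]
  have hHp : ∀ v ∈ L, ∀ x, H (x + v) = H x := by
    intro v hv x
    refine tsum_congr fun ξ => ?_
    rw [planeWave_add_right, planeWave_eq_one ξ.2 hv, mul_one]
  have hGc := continuous_periodizedGaussian L ha
  have hGp : ∀ v ∈ L, ∀ x, periodizedGaussian L a (x + v) = periodizedGaussian L a x :=
    fun v hv x => periodizedGaussian_add L hv x
  have hwp : ∀ ξ ∈ dualLattice L, ∀ v ∈ L, ∀ x, planeWave (-ξ) (x + v) = planeWave (-ξ) x :=
    fun ξ hξ v hv x => by rw [planeWave_add_right, planeWave_eq_one (neg_mem hξ) hv, mul_one]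
  have h := eq_zero_of_integral_cell_mul_planeWave_eq_zero (L := L)
    (f := fun x => (ZLattice.covolume L : ℂ) * periodizedGaussian L a x - K * H x)
    ((continuous_const.mul hGc).sub (continuous_const.mul hHc))
    (fun v hv x => by simp only [hHp v hv, hGp v hv]) ?_ c
  · rw [sub_eq_zero] at h
    simp only [periodizedGaussian, hH] at h
    push_cast at h ⊢
    exact h
  · intro ξ hξ
    have hi1 : Integrable (fun x => periodizedGaussian L a x * planeWave (-ξ) x)
        (volume.restrict (cell L)) :=
      integrableOn_cell_of_periodic (hGc.mul (continuous_planeWave _)) fun v hv x => by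
        simp only [hGp v hv, hwp ξ hξ v hv]
    have hi2 : Integrable (fun x => H x * planeWave (-ξ) x) (volume.restrict (cell L)) :=
      integrableOn_cell_of_periodic (hHc.mul (continuous_planeWave _)) fun v hv x => by
        simp only [hHp v hv, hwp ξ hξ v hv]
    simp only [sub_mul, mul_assoc]
    rw [integral_sub (hi1.const_mul _) (hi2.const_mul _), integral_const_mul, integral_const_mul,
      integral_cell_periodizedGaussian L ha hξ, integral_cell_fourierSeries L hb hξ]
    have : -Real.pi ^ 2 * ‖ξ‖ ^ 2 / a = -b * ‖ξ‖ ^ 2 := by simp only [b]; ring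
    rw [this]
    ring

end Poisson

/-! ### Laplace eigenfunctions on a flat torus. -/

section Eigenfunctions

variable {V : Type*} [NormedAddCommGroup V] [InnerProductSpace ℝ V] [FiniteDimensional ℝ V]

theorem laplacian_eq_sum_fderiv {f : V → ℂ} (hf : ContDiff ℝ 2 f) (x : V) :
    Laplacian.laplacian f x = ∑ i, fderiv ℝ (fun y => fderiv ℝ f y (stdOrthonormalBasis ℝ V i)) x
      (stdOrthonormalBasis ℝ V i) := by
  rw [InnerProductSpace.laplacian_eq_iteratedFDeriv_stdOrthonormalBasis]
  refine Finset.sum_congr rfl fun i _ => ?_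
  have h : DifferentiableAt ℝ (fderiv ℝ f) x :=
    ((hf.fderiv_right (m := 1) (by norm_num)).differentiable one_ne_zero) x
  rw [iteratedFDeriv_two_apply, fderiv_clm_apply h (differentiableAt_const _)]
  simp

theorem sum_inner_stdOrthonormalBasis_sq (ξ : V) :
    ∑ i, inner ℝ ξ (stdOrthonormalBasis ℝ V i) ^ 2 = ‖ξ‖ ^ 2 := by
  rw [← (stdOrthonormalBasis ℝ V).sum_sq_norm_inner_left ξ]
  exact Finset.sum_congr rfl fun i _ => by rw [Real.norm_eq_abs, sq_abs]

theorem laplacian_planeWave (ξ x : V) :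
    Laplacian.laplacian (planeWave ξ) x =
      -((4 * Real.pi ^ 2 * ‖ξ‖ ^ 2 : ℝ) : ℂ) * planeWave ξ x := by
  rw [laplacian_eq_sum_fderiv ((contDiff_planeWave ξ).of_le (by norm_cast))]
  have h : ∀ i, fderiv ℝ (fun y => fderiv ℝ (planeWave ξ) y (stdOrthonormalBasis ℝ V i)) x
      (stdOrthonormalBasis ℝ V i) =
      -((4 * Real.pi ^ 2 * inner ℝ ξ (stdOrthonormalBasis ℝ V i) ^ 2 : ℝ) : ℂ) *
        planeWave ξ x := by
    intro i
    simp only [fderiv_planeWave]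
    rw [fderiv_const_mul ((contDiff_planeWave ξ).differentiable (by simp) x)]
    simp only [smul_apply, fderiv_planeWave, smul_eq_mul]
    push_cast
    linear_combination (4 * (Real.pi : ℂ) ^ 2 * inner ℝ ξ (stdOrthonormalBasis ℝ V i) ^ 2 *
      planeWave ξ x) * I_sq
  simp only [h]
  rw [← Finset.sum_mul, ← sum_inner_stdOrthonormalBasis_sq ξ]
  push_cast
  rw [Finset.mul_sum, ← Finset.sum_neg_distrib]

variable (L : Submodule ℤ V)

/-- The frequencies of the periodic plane waves with Laplace eigenvalue `μ`. -/
def frequencies (μ : ℝ) : Set V := {ξ | ξ ∈ dualLattice L ∧ 4 * Real.pi ^ 2 * ‖ξ‖ ^ 2 = μ}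

variable [DiscreteTopology L] [IsZLattice ℝ L]

theorem finite_frequencies (μ : ℝ) : (frequencies L μ).Finite := by
  refine (finite_norm_le (dualLattice L) (1 + μ)).subset ?_
  rintro ξ ⟨h1, h2⟩
  refine ⟨h1, ?_⟩
  -- Hence ‖ξ‖² ≤ μ, and ‖ξ‖ ≤ 1 + ‖ξ‖² accounts for the radius 1 + μ.
  have : 1 ≤ 4 * Real.pi ^ 2 := by nlinarith [Real.pi_gt_three]
  nlinarith [sq_nonneg (‖ξ‖ - 1), sq_nonneg ‖ξ‖]

variable {L} [MeasurableSpace V] [BorelSpace V]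

/-- Fourier coefficients of the Laplacian of a periodic function. -/
theorem integral_cell_laplacian_mul_planeWave {f : V → ℂ} (hf : ContDiff ℝ 2 f)
    (hper : ∀ v ∈ L, ∀ x, f (x + v) = f x) {ξ : V} (hξ : ξ ∈ dualLattice L) :
    ∫ x in cell L, Laplacian.laplacian f x * planeWave (-ξ) x =
      -((4 * Real.pi ^ 2 * ‖ξ‖ ^ 2 : ℝ) : ℂ) * ∫ x in cell L, f x * planeWave (-ξ) x := by
  have hd : ∀ w, ContDiff ℝ 1 fun y => fderiv ℝ f y w := fun w =>
    (hf.fderiv_right (m := 1) (by norm_num)).clm_apply contDiff_const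
  have hdp : ∀ w, ∀ v ∈ L, ∀ x, fderiv ℝ f (x + v) w = fderiv ℝ f x w := by
    intro w v hv x
    rw [← fderiv_comp_add_right, funext (hper v hv)]
  have hddp : ∀ w, ∀ v ∈ L, ∀ x, fderiv ℝ (fun y => fderiv ℝ f y w) (x + v) w =
      fderiv ℝ (fun y => fderiv ℝ f y w) x w := by
    intro w v hv x
    rw [← fderiv_comp_add_right, funext (hdp w v hv)]
  simp only [laplacian_eq_sum_fderiv hf, Finset.sum_mul]
  rw [integral_finsetSum]
  · simp only [integral_cell_fderiv_mul_planeWave (hd _) (hdp _) hξ,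
      integral_cell_fderiv_mul_planeWave (hf.of_le one_le_two) hper hξ]
    rw [← sum_inner_stdOrthonormalBasis_sq ξ]
    push_cast
    rw [Finset.mul_sum, ← Finset.sum_neg_distrib, Finset.sum_mul]
    refine Finset.sum_congr rfl fun i _ => ?_
    linear_combination (4 * (Real.pi : ℂ) ^ 2 * inner ℝ ξ (stdOrthonormalBasis ℝ V i) ^ 2 *
      ∫ x in cell L, f x * planeWave (-ξ) x) * I_sq
  · intro i _
    refine integrableOn_cell_of_periodic ((((hd _).continuous_fderiv one_ne_zero).clm_apply
      continuous_const).mul (continuous_planeWave _)) fun v hv x => ?_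
    rw [hddp _ v hv, planeWave_add_right, planeWave_eq_one (neg_mem hξ) hv, mul_one]

theorem integral_cell_planeWave_mul_planeWave {η ξ : V} (hη : η ∈ dualLattice L)
    (hξ : ξ ∈ dualLattice L) [Decidable (η = ξ)] :
    ∫ x in cell L, planeWave η x * planeWave (-ξ) x =
      if η = ξ then (ZLattice.covolume L : ℂ) else 0 := by
  simp only [← planeWave_add_left, ← sub_eq_add_neg]
  split_ifs with h
  · simp [h, covolume_eq_volume_real_cell]
  · exact integral_cell_planeWave (sub_mem hη hξ) (sub_ne_zero.2 h)

/-- Smooth periodic eigenfunctions of the Laplacian are finite sums of plane waves. -/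
theorem mem_span_planeWave_of_laplacian_eq {f : V → ℂ} (hf : ContDiff ℝ ∞ f)
    (hper : ∀ v ∈ L, ∀ x, f (x + v) = f x) {μ : ℝ}
    (hΔ : ∀ x, -(Laplacian.laplacian f x) = μ * f x) :
    f ∈ Submodule.span ℂ (Set.range fun ξ : frequencies L μ => planeWave (ξ : V)) := by
  classical
  have hvol : (ZLattice.covolume L : ℂ) ≠ 0 := by
    exact_mod_cast ZLattice.covolume_ne_zero L volume
  have := (finite_frequencies L μ).fintype
  set c : V → ℂ := fun ξ => ∫ x in cell L, f x * planeWave (-ξ) x with hc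
  -- The part of the Fourier series of f with frequencies of eigenvalue μ; all Fourier coefficients
  -- of f - g will vanish.
  set g : V → ℂ := fun x => ∑ ξ : frequencies L μ, (c ξ / ZLattice.covolume L) * planeWave (ξ : V) x
    with hg
  have hfg : f = g := by
    funext x
    refine sub_eq_zero.1 (eq_zero_of_integral_cell_mul_planeWave_eq_zero (L := L)
      (f := fun x => f x - g x) ?_ ?_ ?_ x)
    · exact hf.continuous.sub (continuous_finsetSum _ fun ξ _ =>
        continuous_const.mul (continuous_planeWave _))
    · intro v hv y
      simp only [hper v hv, hg]
      congr 1
      refine Finset.sum_congr rfl fun ξ _ => ?_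
      rw [planeWave_add_right, planeWave_eq_one ξ.2.1 hv, mul_one]
    · intro ξ hξ
      have hpp : ∀ v ∈ L, ∀ x, planeWave (-ξ) (x + v) = planeWave (-ξ) x := fun v hv x => by
        rw [planeWave_add_right, planeWave_eq_one (neg_mem hξ) hv, mul_one]
      have hi1 : Integrable (fun x => f x * planeWave (-ξ) x) (volume.restrict (cell L)) :=
        integrableOn_cell_of_periodic (hf.continuous.mul (continuous_planeWave _)) fun v hv x => by
          simp only [hper v hv, hpp v hv]
      have hi2 : ∀ η : frequencies L μ, Integrable
          (fun x => (c η / ZLattice.covolume L) * (planeWave (η : V) x * planeWave (-ξ) x))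
          (volume.restrict (cell L)) := fun η =>
        (integrableOn_cell_of_periodic ((continuous_planeWave _).mul (continuous_planeWave _))
          fun v hv x => by
            rw [Pi.mul_apply, Pi.mul_apply, hpp v hv, planeWave_add_right,
              planeWave_eq_one η.2.1 hv, mul_one]).const_mul _
      simp only [sub_mul, hg, Finset.sum_mul, mul_assoc]
      rw [integral_sub hi1 (integrable_finsetSum _ fun η _ => hi2 η),
        integral_finsetSum _ fun η _ => hi2 η]
      simp only [integral_const_mul]
      have h1 : ∀ η : frequencies L μ, (c η / ZLattice.covolume L) *
          ∫ x in cell L, planeWave (η : V) x * planeWave (-ξ) x = if (η : V) = ξ then c ξ else 0 := by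
        intro η
        rw [integral_cell_planeWave_mul_planeWave η.2.1 hξ]
        split_ifs with h
        · rw [h]
          field_simp
        · simp
      simp only [h1]
      rw [sub_eq_zero]
      by_cases hμ : 4 * Real.pi ^ 2 * ‖ξ‖ ^ 2 = μ
      · rw [Finset.sum_eq_single (⟨ξ, hξ, hμ⟩ : frequencies L μ)]
        · simp [hc]
        · intro η _ hne
          rw [if_neg fun h => hne (Subtype.ext h)]
        · simp
      · rw [Finset.sum_eq_zero]
        -- Taking Fourier coefficients in the eigenvalue equation gives (4π²‖ξ‖² - μ) c(ξ) = 0.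
        · have h2 := integral_cell_laplacian_mul_planeWave (hf.of_le (by norm_cast)) hper hξ
          have h3 : ∀ x, Laplacian.laplacian f x = -(μ : ℂ) * f x := fun x => by
            linear_combination -hΔ x
          simp only [h3, mul_assoc (-(μ : ℂ)), integral_const_mul] at h2
          have h4 : ((4 * Real.pi ^ 2 * ‖ξ‖ ^ 2 : ℝ) : ℂ) - μ ≠ 0 := by
            rw [← Complex.ofReal_sub]
            exact_mod_cast sub_ne_zero.2 hμ
          refine (mul_eq_zero.1 (?_ : (((4 * Real.pi ^ 2 * ‖ξ‖ ^ 2 : ℝ) : ℂ) - μ) *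
            ∫ x in cell L, f x * planeWave (-ξ) x = 0)).resolve_left h4
          linear_combination h2
        · intro η _
          rw [if_neg]
          intro h
          exact hμ (h ▸ η.2.2)
  rw [hfg]
  have : g = ∑ ξ : frequencies L μ, (c ξ / ZLattice.covolume L) • planeWave (ξ : V) := by
    funext x
    simp [hg]
  rw [this]
  exact Submodule.sum_mem _ fun ξ _ => Submodule.smul_mem _ _ (Submodule.subset_span ⟨ξ, rfl⟩)

end Eigenfunctions

/-! ### Asymptotics and uniqueness for Dirichlet series. -/

section Dirichlet

/-- A Dirichlet series with locally finite exponents is exponentially close to its leading term. -/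
theorem tendsto_rpow_mul_dirichlet_sub {c : ℝ → ℝ} (hfin : ∀ R, {l | l ≤ R ∧ c l ≠ 0}.Finite)
    (hsum : ∀ s : ℝ, 0 < s → Summable fun l => c l * Real.exp (-s * l)) {l₀ : ℝ}
    (hlow : ∀ l < l₀, c l = 0) (k : ℝ) :
    Tendsto (fun s : ℝ => s ^ k * (Real.exp (s * l₀) * ∑' l, c l * Real.exp (-s * l) - c l₀))
      atTop (𝓝 0) := by
  classical
  -- Local finiteness leaves a gap above the leading exponent; only exponents up to l₀ + 1 need
  -- inspection, whence the minimum with 1.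
  obtain ⟨δ, hδ, hgap⟩ : ∃ δ > 0, ∀ l, l ≠ l₀ → c l ≠ 0 → δ ≤ l - l₀ := by
    have hf : ((fun l => l - l₀) '' ({l | l ≤ l₀ + 1 ∧ c l ≠ 0} \ {l₀})).Finite :=
      ((hfin _).subset Set.sdiff_subset).image _
    have hpos : ∀ l, l ≠ l₀ → c l ≠ 0 → 0 < l - l₀ := fun l h1 h2 =>
      sub_pos.2 (lt_of_le_of_ne (not_lt.1 fun h => h2 (hlow l h)) (Ne.symm h1))
    rcases Set.eq_empty_or_nonempty ({l | l ≤ l₀ + 1 ∧ c l ≠ 0} \ {l₀}) with he | hne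
    · refine ⟨1, one_pos, fun l h1 h2 => ?_⟩
      by_contra hlt
      have : l ∈ ({l | l ≤ l₀ + 1 ∧ c l ≠ 0} \ {l₀}) := ⟨⟨by linarith, h2⟩, h1⟩
      rw [he] at this
      exact this
    · obtain ⟨m, ⟨lm, hlm, rfl⟩, hm⟩ := Set.exists_min_image _ id hf (hne.image _)
      refine ⟨min 1 (lm - l₀), lt_min one_pos (hpos lm hlm.2 hlm.1.2), fun l h1 h2 => ?_⟩
      by_cases hl : l ≤ l₀ + 1
      · exact (min_le_right _ _).trans (hm _ ⟨l, ⟨⟨hl, h2⟩, h1⟩, rfl⟩)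
      · exact (min_le_left _ _).trans (by linarith)
  set B := ∑' l, ‖c l * Real.exp (-1 * l)‖ * Real.exp l₀ with hB
  have hBs : Summable fun l => ‖c l * Real.exp (-1 * l)‖ * Real.exp l₀ :=
    (hsum 1 one_pos).norm.mul_right _
  have hlim : Tendsto (fun s : ℝ => (s ^ k * Real.exp (-δ * s)) * (Real.exp δ * B)) atTop (𝓝 0) := by
    simpa using (tendsto_rpow_mul_exp_neg_mul_atTop_nhds_zero k δ hδ).mul_const (Real.exp δ * B)
  refine squeeze_zero_norm' ?_ hlim
  filter_upwards [eventually_ge_atTop 1] with s hs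
  have hs0 : 0 < s := one_pos.trans_le hs
  have hg : Summable fun l => Real.exp (s * l₀) * (c l * Real.exp (-s * l)) :=
    (hsum s hs0).mul_left _
  have h1 : Real.exp (s * l₀) * ∑' l, c l * Real.exp (-s * l) - c l₀ =
      ∑' l, if l = l₀ then 0 else Real.exp (s * l₀) * (c l * Real.exp (-s * l)) := by
    rw [← tsum_mul_left, hg.tsum_eq_add_tsum_ite l₀]
    have : Real.exp (s * l₀) * (c l₀ * Real.exp (-s * l₀)) = c l₀ := by
      rw [mul_left_comm, ← Real.exp_add]
      simp
    rw [this, add_sub_cancel_left]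
  have h2 : ∀ l, ‖if l = l₀ then 0 else Real.exp (s * l₀) * (c l * Real.exp (-s * l))‖ ≤
      Real.exp (-δ * s) * Real.exp δ * (‖c l * Real.exp (-1 * l)‖ * Real.exp l₀) := by
    intro l
    split_ifs with hl
    · simp only [norm_zero]
      positivity
    · by_cases hc : c l = 0
      · simp [hc]
      · rw [norm_mul, norm_mul, norm_mul]
        simp only [Real.norm_eq_abs, Real.abs_exp]
        -- For s ≥ 1, split s = (s - 1) + 1: the first part gains from the gap, the second keeps the
        -- series at s = 1 as a summable majorant.
        have : Real.exp (s * l₀) * Real.exp (-s * l) ≤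
            Real.exp (-δ * s) * Real.exp δ * (Real.exp (-1 * l) * Real.exp l₀) := by
          simp only [← Real.exp_add, Real.exp_le_exp]
          nlinarith [hgap l hl hc]
        calc _ = |c l| * (Real.exp (s * l₀) * Real.exp (-s * l)) := by ring
          _ ≤ |c l| * (Real.exp (-δ * s) * Real.exp δ * (Real.exp (-1 * l) * Real.exp l₀)) := by
              gcongr
          _ = _ := by ring
  rw [h1, norm_mul, Real.norm_of_nonneg (by positivity)]
  have h3 := tsum_of_norm_bounded ((hBs.mul_left (Real.exp (-δ * s) * Real.exp δ)).hasSum) h2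
  rw [tsum_mul_left] at h3
  calc _ ≤ s ^ k * (Real.exp (-δ * s) * Real.exp δ * B) := by gcongr
    _ = _ := by ring

/-- Uniqueness of the coefficients of finite sums of Dirichlet series multiplied by half-integral
powers of the variable. -/
theorem eq_zero_of_sum_rpow_mul_dirichlet_eq_zero {N : ℕ} {c : ℕ → ℝ → ℝ}
    (hfin : ∀ d R, {l | l ≤ R ∧ c d l ≠ 0}.Finite)
    (hsum : ∀ d, ∀ s : ℝ, 0 < s → Summable fun l => c d l * Real.exp (-s * l))
    (h0 : ∀ s : ℝ, 0 < s →
      ∑ d ∈ Finset.range N, s ^ ((d : ℝ) / 2) * ∑' l, c d l * Real.exp (-s * l) = 0) :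
    ∀ d < N, ∀ l, c d l = 0 := by
  classical
  by_contra! hcon
  obtain ⟨d₁, hd₁, l₁, hl₁⟩ := hcon
  -- The dominant term as s → ∞ has the least exponent l₀ occurring in any of the series and then,
  -- among these series, the highest power d₀.
  obtain ⟨l₀, ⟨d₂, hd₂, hl₂⟩, hmin⟩ : ∃ l₀, (∃ d < N, c d l₀ ≠ 0) ∧
      ∀ d < N, ∀ l < l₀, c d l = 0 := by
    have hf : (⋃ d ∈ Finset.range N, {l | l ≤ l₁ ∧ c d l ≠ 0}).Finite :=
      (Finset.range N).finite_toSet.biUnion fun d _ => hfin d l₁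
    obtain ⟨l₀, hl₀, hm⟩ := Set.exists_min_image _ id hf
      ⟨l₁, Set.mem_biUnion (Finset.mem_coe.2 (Finset.mem_range.2 hd₁)) ⟨le_rfl, hl₁⟩⟩
    simp only [Set.mem_iUnion, Finset.mem_range, Set.mem_ofPred_eq, exists_prop] at hl₀ hm
    obtain ⟨d, hd, hle, hne⟩ := hl₀
    refine ⟨l₀, ⟨d, hd, hne⟩, fun d' hd' l hl => ?_⟩
    by_contra h
    exact absurd (hm l ⟨d', hd', hl.le.trans hle, h⟩) (not_le.2 hl)
  obtain ⟨d₀, hd₀, hmax⟩ := Finset.exists_max_image ((Finset.range N).filter fun d => c d l₀ ≠ 0) id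
    ⟨d₂, by simp [hd₂, hl₂]⟩
  simp only [Finset.mem_filter, Finset.mem_range, id] at hd₀ hmax
  -- After division by the dominant factor, lower powers decay, higher powers have no term at l₀,
  -- and the remainders are exponentially small. Only the coefficient at d₀ and l₀ survives.
  have hlim : Tendsto (fun s : ℝ => ∑ d ∈ Finset.range N,
      (s ^ (((d : ℝ) - d₀) / 2) *
        (Real.exp (s * l₀) * ∑' l, c d l * Real.exp (-s * l) - c d l₀) +
      s ^ (((d : ℝ) - d₀) / 2) * c d l₀)) atTop
      (𝓝 (∑ d ∈ Finset.range N, (0 + if d = d₀ then c d₀ l₀ else 0))) := by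
    refine tendsto_finsetSum _ fun d hd => Tendsto.add
      (tendsto_rpow_mul_dirichlet_sub (hfin d) (hsum d) (hmin d (Finset.mem_range.1 hd)) _) ?_
    split_ifs with h
    · subst h
      simp
    · rcases lt_or_gt_of_ne h with hlt | hgt
      · have hneg : 0 < -(((d : ℝ) - d₀) / 2) := by
          have : (d : ℝ) < d₀ := by exact_mod_cast hlt
          linarith
        have := (tendsto_rpow_neg_atTop hneg).mul_const (c d l₀)
        simpa using this
      · have : c d l₀ = 0 := by
          by_contra h2
          exact absurd (hmax d ⟨Finset.mem_range.1 hd, h2⟩) (not_le.2 hgt)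
        simp [this]
  have hzero : ∀ᶠ s : ℝ in atTop, ∑ d ∈ Finset.range N,
      (s ^ (((d : ℝ) - d₀) / 2) *
        (Real.exp (s * l₀) * ∑' l, c d l * Real.exp (-s * l) - c d l₀) +
      s ^ (((d : ℝ) - d₀) / 2) * c d l₀) = 0 := by
    filter_upwards [eventually_gt_atTop 0] with s hs
    have h1 : ∀ d ∈ Finset.range N, (s ^ (((d : ℝ) - d₀) / 2) *
        (Real.exp (s * l₀) * ∑' l, c d l * Real.exp (-s * l) - c d l₀) +
      s ^ (((d : ℝ) - d₀) / 2) * c d l₀) = (s ^ (-(d₀ : ℝ) / 2) * Real.exp (s * l₀)) *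
        (s ^ ((d : ℝ) / 2) * ∑' l, c d l * Real.exp (-s * l)) := by
      intro d _
      have : s ^ (((d : ℝ) - d₀) / 2) = s ^ (-(d₀ : ℝ) / 2) * s ^ ((d : ℝ) / 2) := by
        rw [← Real.rpow_add hs]
        ring_nf
      rw [this]
      ring
    rw [Finset.sum_congr rfl h1, ← Finset.mul_sum, h0 s hs, mul_zero]
  have h := tendsto_nhds_unique (hlim.congr' hzero) tendsto_const_nhds
  rw [Finset.sum_congr rfl fun d _ => zero_add _, Finset.sum_ite_eq' ] at h
  simp only [Finset.mem_range, hd₀.1, if_true] at h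
  exact hd₀.2 h

end Dirichlet

end LatticeFourier

/-! ### Space groups, point groups and projected lattices. -/

namespace FlatManifold

open LatticeFourier Module

variable {n : ℕ}

theorem apply_eq_linearPart_add (γ : Isom n) (x : Euc n) : γ x = linearPart n γ x + γ 0 := by
  have h := γ.map_vadd 0 x
  rwa [vadd_eq_add, vadd_eq_add, add_zero] at h

theorem mem_translationLattice {Γ : Subgroup (Isom n)} {v : Euc n} :
    v ∈ translationLattice Γ ↔ AffineIsometryEquiv.constVAdd ℝ (Euc n) v ∈ Γ := Iff.rfl

/-- Conjugating the translation by v with γ gives the translation by the linear part of γ applied to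
v. -/
theorem linearPart_mem_translationLattice {Γ : Subgroup (Isom n)} {γ : Isom n} (hγ : γ ∈ Γ)
    {v : Euc n} (hv : v ∈ translationLattice Γ) : linearPart n γ v ∈ translationLattice Γ := by
  rw [mem_translationLattice] at hv ⊢
  have h : AffineIsometryEquiv.constVAdd ℝ (Euc n) (linearPart n γ v) =
      γ * AffineIsometryEquiv.constVAdd ℝ (Euc n) v * γ⁻¹ := by
    rw [eq_mul_inv_iff_mul_eq]
    ext1 x
    change linearPart n γ v + γ x = γ (v + x)
    rw [apply_eq_linearPart_add γ x, apply_eq_linearPart_add γ (v + x), map_add, add_assoc]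
  rw [h]
  exact Γ.mul_mem (Γ.mul_mem hγ hv) (Γ.inv_mem hγ)

/-- Elements of `Γ` with the same linear part differ by a translation of the lattice. -/
theorem exists_mem_translationLattice_of_linearPart_eq {Γ : Subgroup (Isom n)} {γ δ : Isom n}
    (hγ : γ ∈ Γ) (hδ : δ ∈ Γ) (h : linearPart n γ = linearPart n δ) :
    ∃ w ∈ translationLattice Γ, ∀ x, δ x = γ x + w := by
  refine ⟨δ 0 - γ 0, ?_, fun x => ?_⟩
  · have h2 : AffineIsometryEquiv.constVAdd ℝ (Euc n) (δ 0 - γ 0) = δ * γ⁻¹ := by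
      rw [eq_mul_inv_iff_mul_eq]
      ext1 x
      change (δ 0 - γ 0) + γ x = δ x
      rw [apply_eq_linearPart_add γ x, apply_eq_linearPart_add δ x, h]
      abel
    rw [mem_translationLattice, h2]
    exact Γ.mul_mem hδ (Γ.inv_mem hγ)
  · rw [apply_eq_linearPart_add γ x, apply_eq_linearPart_add δ x, h]
    abel

theorem mem_pointGroup {Γ : Subgroup (Isom n)} {M : Euc n ≃ₗᵢ[ℝ] Euc n} :
    M ∈ pointGroup Γ ↔ ∃ γ ∈ Γ, linearPart n γ = M := Subgroup.mem_map

theorem pointGroup_apply_mem {Γ : Subgroup (Isom n)} {M : Euc n ≃ₗᵢ[ℝ] Euc n}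
    (hM : M ∈ pointGroup Γ) {v : Euc n} (hv : v ∈ translationLattice Γ) :
    M v ∈ translationLattice Γ := by
  obtain ⟨γ, hγ, rfl⟩ := mem_pointGroup.1 hM
  exact linearPart_mem_translationLattice hγ hv

/-- An element of the point group is determined by the images of a lattice basis, and each image is
one of the finitely many lattice vectors in a ball. -/
theorem finite_pointGroup {Γ : Subgroup (Isom n)} (hΓ : IsFlatSpaceGroup Γ) :
    Finite (pointGroup Γ) := by
  have := hΓ.discrete
  have : IsZLattice ℝ (translationLattice Γ) := ⟨hΓ.span_top⟩
  let b := (Free.chooseBasis ℤ (translationLattice Γ))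
  let B := b.ofZLatticeBasis ℝ (translationLattice Γ)
  have hB : ∀ i, B i ∈ translationLattice Γ := fun i => by
    simp only [B, Basis.ofZLatticeBasis_apply]
    exact (b i).2
  have hfin : ∀ i, Finite {v : Euc n | v ∈ translationLattice Γ ∧ ‖v‖ ≤ ‖B i‖} := fun i =>
    (finite_norm_le (translationLattice Γ) ‖B i‖).to_subtype
  let F : pointGroup Γ → ∀ i, {v : Euc n | v ∈ translationLattice Γ ∧ ‖v‖ ≤ ‖B i‖} := fun M i =>
    ⟨(M : Euc n ≃ₗᵢ[ℝ] Euc n) (B i), pointGroup_apply_mem M.2 (hB i), by simp⟩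
  refine Finite.of_injective F fun M M' h => ?_
  refine Subtype.ext (LinearIsometryEquiv.toLinearEquiv_injective
    (LinearEquiv.toLinearMap_injective (B.ext fun i => ?_)))
  exact congrArg Subtype.val (congrFun h i)

theorem mem_fixedSpace {M : Euc n ≃ₗᵢ[ℝ] Euc n} {v : Euc n} : v ∈ fixedSpace M ↔ M v = v := Iff.rfl

/-- The orthogonal projection onto the fixed space is invariant. -/
theorem orthogonalProjectionOnto_fixedSpace_apply (M : Euc n ≃ₗᵢ[ℝ] Euc n) (v : Euc n) :
    (fixedSpace M).orthogonalProjectionOnto (M v) = (fixedSpace M).orthogonalProjectionOnto v := by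
  rw [← sub_eq_zero, ← map_sub]
  refine (Submodule.orthogonalProjectionOnto_eq_zero_iff).2 ?_
  rw [Submodule.mem_orthogonal]
  intro w hw
  rw [inner_sub_right, sub_eq_zero]
  conv_lhs => rw [← mem_fixedSpace.1 hw]
  exact M.inner_map_map w v

/-- The image of the translation lattice under the projection onto the fixed space of `γ`. -/
def projectedLattice (Γ : Subgroup (Isom n)) (γ : Isom n) :
    Submodule ℤ (fixedSpace (linearPart n γ)) :=
  (translationLattice Γ).map
    ((fixedSpace (linearPart n γ)).orthogonalProjectionOnto.toLinearMap.restrictScalars ℤ)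

theorem mem_projectedLattice {Γ : Subgroup (Isom n)} {γ : Isom n}
    {w : fixedSpace (linearPart n γ)} : w ∈ projectedLattice Γ γ ↔ ∃ v ∈ translationLattice Γ,
      (fixedSpace (linearPart n γ)).orthogonalProjectionOnto v = w := Submodule.mem_map

/-- Projecting to the fixed space erases the effect of the linear part, so after projection γ only
shifts by the projection of γ(0). -/
theorem mem_shiftedLattice {Γ : Subgroup (Isom n)} {γ : Isom n}
    {w : fixedSpace (linearPart n γ)} :
    w ∈ shiftedLattice Γ γ ↔ ∃ u ∈ projectedLattice Γ γ,
      w = u + (fixedSpace (linearPart n γ)).orthogonalProjectionOnto (γ 0) := by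
  have key : ∀ v, (fixedSpace (linearPart n γ)).orthogonalProjectionOnto (γ v) =
      (fixedSpace (linearPart n γ)).orthogonalProjectionOnto v +
        (fixedSpace (linearPart n γ)).orthogonalProjectionOnto (γ 0) := by
    intro v
    rw [apply_eq_linearPart_add γ v, map_add, orthogonalProjectionOnto_fixedSpace_apply]
  constructor
  · rintro ⟨_, ⟨v, hv, rfl⟩, rfl⟩
    exact ⟨_, mem_projectedLattice.2 ⟨v, hv, rfl⟩, key v⟩
  · rintro ⟨u, hu, rfl⟩
    obtain ⟨v, hv, rfl⟩ := mem_projectedLattice.1 hu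
    exact ⟨_, ⟨v, hv, rfl⟩, key v⟩

theorem differenceLattice_shiftedLattice (Γ : Subgroup (Isom n)) (γ : Isom n) :
    differenceLattice (shiftedLattice Γ γ) = projectedLattice Γ γ := by
  apply le_antisymm
  · refine Submodule.span_le.2 ?_
    rintro _ ⟨x, hx, y, hy, rfl⟩
    obtain ⟨u, hu, rfl⟩ := mem_shiftedLattice.1 hx
    obtain ⟨u', hu', rfl⟩ := mem_shiftedLattice.1 hy
    rw [add_sub_add_right_eq_sub]
    exact sub_mem hu hu'
  · intro u hu
    refine Submodule.subset_span ⟨_, mem_shiftedLattice.2 ⟨u, hu, rfl⟩, _,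
      mem_shiftedLattice.2 ⟨0, zero_mem _, rfl⟩, ?_⟩
    rw [add_sub_add_right_eq_sub, sub_zero]

/-- The shifted lattice is parametrized by the projected lattice. -/
def shiftedLatticeEquiv (Γ : Subgroup (Isom n)) (γ : Isom n) :
    projectedLattice Γ γ ≃ shiftedLattice Γ γ where
  toFun u := ⟨u + (fixedSpace (linearPart n γ)).orthogonalProjectionOnto (γ 0),
    mem_shiftedLattice.2 ⟨u, u.2, rfl⟩⟩
  invFun w := ⟨w - (fixedSpace (linearPart n γ)).orthogonalProjectionOnto (γ 0), by
    obtain ⟨u, hu, h⟩ := mem_shiftedLattice.1 w.2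
    rw [h, add_sub_cancel_right]
    exact hu⟩
  left_inv u := by simp
  right_inv w := by simp

/-- A positive multiple of the projection of a lattice vector lies in the lattice. -/
theorem exists_nsmul_orthogonalProjectionOnto_mem {Γ : Subgroup (Isom n)}
    (hΓ : IsFlatSpaceGroup Γ) {γ : Isom n} (hγ : γ ∈ Γ) :
    ∃ N : ℕ, N ≠ 0 ∧ ∀ u ∈ projectedLattice Γ γ, N • (u : Euc n) ∈ translationLattice Γ := by
  have := finite_pointGroup hΓ
  set M := linearPart n γ
  have hM : M ∈ pointGroup Γ := mem_pointGroup.2 ⟨γ, hγ, rfl⟩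
  obtain ⟨N, hN, hMN⟩ : ∃ N : ℕ, 0 < N ∧ M ^ N = 1 := by
    obtain ⟨N, hN, h⟩ := isOfFinOrder_iff_pow_eq_one.1
      (isOfFinOrder_of_finite (⟨M, hM⟩ : pointGroup Γ))
    exact ⟨N, hN, congrArg Subtype.val h⟩
  refine ⟨N, hN.ne', ?_⟩
  intro u hu
  obtain ⟨v, hv, rfl⟩ := mem_projectedLattice.1 hu
  -- The sum over the powers of M is a fixed lattice vector, and every summand has the same
  -- projection as v; so it equals N times that projection.
  set s : Euc n := ∑ k ∈ Finset.range N, (M ^ k) v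
  have hs : s ∈ fixedSpace M := by
    rw [mem_fixedSpace, map_sum]
    have h1 : ∀ k, M ((M ^ k) v) = (M ^ (k + 1)) v := fun k => by
      rw [pow_succ']
      rfl
    simp only [h1]
    have h2 := Finset.sum_range_succ' (fun k => (M ^ k) v) N
    rw [Finset.sum_range_succ, hMN, pow_zero] at h2
    exact (add_right_cancel h2).symm
  have h3 : ∀ k, (fixedSpace M).orthogonalProjectionOnto ((M ^ k) v) =
      (fixedSpace M).orthogonalProjectionOnto v := by
    intro k
    induction k with
    | zero => simp
    | succ k ih =>
      rw [pow_succ']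
      exact (orthogonalProjectionOnto_fixedSpace_apply M ((M ^ k) v)).trans ih
  have h4 : N • ((fixedSpace M).orthogonalProjectionOnto v : Euc n) = s := by
    have h5 : (fixedSpace M).orthogonalProjectionOnto s =
        N • (fixedSpace M).orthogonalProjectionOnto v := by
      simp [s, map_sum, h3]
    rw [← Submodule.coe_smul_of_tower, ← h5]
    exact congrArg Subtype.val
      (Submodule.orthogonalProjectionOnto_mem_subspace_eq_self (⟨s, hs⟩ : fixedSpace M))
  rw [h4]
  exact sum_mem fun k _ => pointGroup_apply_mem (pow_mem hM k) hv

/-- A projection of a lattice need not be discrete in general. Here multiplication by a suitable N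
maps it continuously and injectively into 𝒯. -/
theorem discreteTopology_projectedLattice {Γ : Subgroup (Isom n)}
    (hΓ : IsFlatSpaceGroup Γ) {γ : Isom n} (hγ : γ ∈ Γ) :
    DiscreteTopology (projectedLattice Γ γ) := by
  have := hΓ.discrete
  obtain ⟨N, hN, h⟩ := exists_nsmul_orthogonalProjectionOnto_mem hΓ hγ
  refine DiscreteTopology.of_continuous_injective
    (f := fun u : projectedLattice Γ γ =>
      (⟨N • ((u : fixedSpace (linearPart n γ)) : Euc n), h u u.2⟩ : translationLattice Γ)) ?_ ?_
  · refine Continuous.subtype_mk ?_ _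
    fun_prop
  · intro u u' huu
    have := congrArg Subtype.val huu
    simp only [← Nat.cast_smul_eq_nsmul ℝ] at this
    exact Subtype.ext (Subtype.ext
      (smul_right_injective (Euc n) (Nat.cast_ne_zero.2 hN : (N : ℝ) ≠ 0) this))

theorem isZLattice_projectedLattice {Γ : Subgroup (Isom n)}
    (hΓ : IsFlatSpaceGroup Γ) {γ : Isom n} (hγ : γ ∈ Γ) :
    have := discreteTopology_projectedLattice hΓ hγ
    IsZLattice ℝ (projectedLattice Γ γ) := by
  intro _
  refine ⟨?_⟩
  set π := (fixedSpace (linearPart n γ)).orthogonalProjectionOnto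
  have h : (projectedLattice Γ γ : Set (fixedSpace (linearPart n γ))) =
      π.toLinearMap '' (translationLattice Γ : Set (Euc n)) := rfl
  rw [h, Submodule.span_image, hΓ.span_top, Submodule.map_top, LinearMap.range_eq_top]
  intro w
  exact ⟨w, Submodule.orthogonalProjectionOnto_mem_subspace_eq_self w⟩

/-- A vector of the fixed space has the same inner product with v as with the projection of v. Thus
the dual of the projected lattice consists of exactly the frequencies seen by the trace of γ. -/
theorem mem_dualLattice_projectedLattice {Γ : Subgroup (Isom n)} {γ : Isom n}
    {ξ : fixedSpace (linearPart n γ)} :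
    ξ ∈ dualLattice (projectedLattice Γ γ) ↔ (ξ : Euc n) ∈ dualLattice (translationLattice Γ) := by
  simp only [mem_dualLattice]
  constructor
  · intro h v hv
    obtain ⟨k, hk⟩ := h _ (mem_projectedLattice.2 ⟨v, hv, rfl⟩)
    exact ⟨k, by rw [hk, Submodule.inner_orthogonalProjectionOnto_eq_of_mem_left]⟩
  · intro h u hu
    obtain ⟨v, hv, rfl⟩ := mem_projectedLattice.1 hu
    obtain ⟨k, hk⟩ := h v hv
    exact ⟨k, by rw [hk, Submodule.inner_orthogonalProjectionOnto_eq_of_mem_left]⟩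

theorem planeWave_orthogonalProjectionOnto {W : Submodule ℝ (Euc n)} (ξ : W) (x : Euc n) :
    planeWave ξ (W.orthogonalProjectionOnto x) = planeWave (ξ : Euc n) x := by
  simp only [planeWave, Submodule.inner_orthogonalProjectionOnto_eq_of_mem_left]

end FlatManifold

/-! ### Linear independence of plane waves. -/

namespace LatticeFourier

section LinearIndependence

variable {V : Type*} [NormedAddCommGroup V] [InnerProductSpace ℝ V]

theorem planeWave_injective : Function.Injective (planeWave : V → V → ℂ) := by
  intro ξ η h
  by_contra hne
  have h0 : ξ - η ≠ 0 := sub_ne_zero.2 hne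
  obtain ⟨y, h1⟩ := exists_planeWave_eq_neg_one h0
  have h2 : planeWave ξ y = planeWave (ξ - η) y * planeWave η y := by
    rw [← planeWave_add_left, sub_add_cancel]
  rw [h, h1, neg_one_mul, eq_neg_iff_add_eq_zero, ← two_mul] at h2
  exact planeWave_ne_zero η y ((mul_eq_zero.1 h2).resolve_left two_ne_zero)

/-- Distinct plane waves are distinct characters of the additive group, so Dedekind's independence
of characters applies. -/
theorem linearIndependent_planeWave : LinearIndependent ℂ (planeWave : V → V → ℂ) := by
  let χ : V → (Multiplicative V →* ℂ) := fun ξ =>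
    { toFun := fun x => planeWave ξ x.toAdd
      map_one' := planeWave_zero_right ξ
      map_mul' := fun x y => planeWave_add_right ξ x.toAdd y.toAdd }
  have hχ : Function.Injective χ := fun ξ η h =>
    planeWave_injective (funext fun x => DFunLike.congr_fun h (Multiplicative.ofAdd x))
  exact (linearIndependent_monoidHom (Multiplicative V) ℂ).comp χ hχ

end LinearIndependence

end LatticeFourier

/-! ### Eigenspaces of the torus and multiplicities as character sums. -/

namespace FlatManifold

open LatticeFourier Module

variable {n : ℕ} (Γ : Subgroup (Isom n)) (μ : ℝ)

/-- The space of Laplace eigenfunctions of the torus `ℝⁿ / 𝒯`, as periodic functions. -/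
def torusEigenspace : Submodule ℂ (Euc n → ℂ) :=
  Submodule.span ℂ (Set.range fun ξ : frequencies (translationLattice Γ) μ => planeWave (ξ : Euc n))

/-- The plane waves are a basis of the eigenspaces of the torus. -/
def torusEigenbasis : Basis (frequencies (translationLattice Γ) μ) ℂ (torusEigenspace Γ μ) :=
  Basis.span (linearIndependent_planeWave.comp
    (Subtype.val : frequencies (translationLattice Γ) μ → Euc n)
    Subtype.val_injective)

theorem torusEigenbasis_apply (ξ : frequencies (translationLattice Γ) μ) :
    (torusEigenbasis Γ μ ξ : Euc n → ℂ) = planeWave (ξ : Euc n) :=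
  congrArg Subtype.val (Basis.span_apply _ _)

variable {Γ μ}

theorem finiteDimensional_torusEigenspace (hΓ : IsFlatSpaceGroup Γ) :
    FiniteDimensional ℂ (torusEigenspace Γ μ) := by
  have := hΓ.discrete
  have : IsZLattice ℝ (translationLattice Γ) := ⟨hΓ.span_top⟩
  have := (finite_frequencies (translationLattice Γ) μ).to_subtype
  exact Module.Finite.of_basis (torusEigenbasis Γ μ)

theorem contDiff_and_laplacian_of_mem_torusEigenspace {f : Euc n → ℂ}
    (hf : f ∈ torusEigenspace Γ μ) :
    ContDiff ℝ ∞ f ∧ ∀ x, -(Laplacian.laplacian f x) = μ * f x := by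
  induction hf using Submodule.span_induction with
  | mem f hf =>
    obtain ⟨ξ, rfl⟩ := hf
    refine ⟨contDiff_planeWave _, fun x => ?_⟩
    rw [laplacian_planeWave, ξ.2.2, neg_mul, neg_neg]
  | zero =>
    have h : (0 : Euc n → ℂ) = fun _ => (0 : ℂ) := rfl
    refine ⟨h ▸ contDiff_const, fun x => ?_⟩
    rw [h, InnerProductSpace.laplacian_const]
    simp
  | add f g _ _ hf hg =>
    refine ⟨hf.1.add hg.1, fun x => ?_⟩
    rw [ContDiffAt.laplacian_add (hf.1.contDiffAt.of_le (by norm_cast))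
      (hg.1.contDiffAt.of_le (by norm_cast)), neg_add, hf.2, hg.2, Pi.add_apply, mul_add]
  | smul c f _ hf =>
    refine ⟨hf.1.const_smul c, fun x => ?_⟩
    rw [InnerProductSpace.laplacian_smul c (hf.1.contDiffAt.of_le (by norm_cast)), ← smul_neg, hf.2,
      Pi.smul_apply, smul_eq_mul, smul_eq_mul]
    ring

theorem torusEigenspace_add_apply {f : Euc n → ℂ} (hf : f ∈ torusEigenspace Γ μ) {v : Euc n}
    (hv : v ∈ translationLattice Γ) (x : Euc n) : f (x + v) = f x := by
  induction hf using Submodule.span_induction with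
  | mem f hf =>
    obtain ⟨ξ, rfl⟩ := hf
    change planeWave (ξ : Euc n) (x + v) = planeWave (ξ : Euc n) x
    rw [planeWave_add_right, planeWave_eq_one ξ.2.1 hv, mul_one]
  | zero => rfl
  | add f g _ _ hf hg => rw [Pi.add_apply, Pi.add_apply, hf, hg]
  | smul c f _ hf => rw [Pi.smul_apply, Pi.smul_apply, hf]

/-- For γ : x ↦ Mx + b, orthogonality gives ⟨ξ, Mx + b⟩ = ⟨M⁻¹ξ, x⟩ + ⟨ξ, b⟩. -/
theorem planeWave_comp_isom (γ : Isom n) (ξ : Euc n) :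
    planeWave ξ ∘ γ = planeWave ξ (γ 0) • planeWave ((linearPart n γ)⁻¹ ξ) := by
  funext x
  have h := planeWave_linearIsometryEquiv (linearPart n γ) ((linearPart n γ)⁻¹ ξ) x
  have h2 : linearPart n γ ((linearPart n γ)⁻¹ ξ) = ξ := (linearPart n γ).apply_symm_apply ξ
  rw [h2] at h
  rw [Function.comp_apply, apply_eq_linearPart_add γ x, planeWave_add_right, Pi.smul_apply,
    smul_eq_mul, h, mul_comm]

theorem inv_linearPart_mem_frequencies {γ : Isom n} (hγ : γ ∈ Γ) {ξ : Euc n}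
    (hξ : ξ ∈ frequencies (translationLattice Γ) μ) :
    (linearPart n γ)⁻¹ ξ ∈ frequencies (translationLattice Γ) μ := by
  refine ⟨mem_dualLattice.2 fun v hv => ?_, ?_⟩
  · obtain ⟨k, hk⟩ := mem_dualLattice.1 hξ.1 _ (linearPart_mem_translationLattice hγ hv)
    refine ⟨k, hk.trans ?_⟩
    rw [← (linearPart n γ).inner_map_map ((linearPart n γ)⁻¹ ξ) v]
    congr 1
    exact ((linearPart n γ).apply_symm_apply ξ).symm
  · rw [← hξ.2]
    congr 2
    exact (linearPart n γ).symm.norm_map ξ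

theorem comp_mem_torusEigenspace {γ : Isom n} (hγ : γ ∈ Γ) {f : Euc n → ℂ}
    (hf : f ∈ torusEigenspace Γ μ) : f ∘ γ ∈ torusEigenspace Γ μ := by
  induction hf using Submodule.span_induction with
  | mem f hf =>
    obtain ⟨ξ, rfl⟩ := hf
    change planeWave (ξ : Euc n) ∘ γ ∈ torusEigenspace Γ μ
    rw [planeWave_comp_isom]
    exact Submodule.smul_mem _ _ (Submodule.subset_span
      ⟨⟨_, inv_linearPart_mem_frequencies hγ ξ.2⟩, rfl⟩)
  | zero => exact zero_mem _
  | add f g _ _ hf hg => exact add_mem hf hg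
  | smul c f _ hf => exact Submodule.smul_mem _ c hf

variable (Γ μ) in
/-- The action of `Γ` on the eigenspaces of the torus by composition. -/
def pullback (γ : Γ) : torusEigenspace Γ μ →ₗ[ℂ] torusEigenspace Γ μ :=
  (LinearMap.funLeft ℂ ℂ (γ : Isom n)).restrict fun _ hf => comp_mem_torusEigenspace γ.2 hf

theorem pullback_apply (γ : Γ) (f : torusEigenspace Γ μ) (x : Euc n) :
    (pullback Γ μ γ f : Euc n → ℂ) x = (f : Euc n → ℂ) ((γ : Isom n) x) := rfl

/-- Lattice translations act trivially on torus eigenfunctions, so the action factors through the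
point group and representatives may be chosen freely. -/
theorem pullback_eq_of_linearPart_eq {γ δ : Γ}
    (h : linearPart n (γ : Isom n) = linearPart n (δ : Isom n)) :
    pullback Γ μ γ = pullback Γ μ δ := by
  obtain ⟨w, hw, hδ⟩ := exists_mem_translationLattice_of_linearPart_eq γ.2 δ.2 h
  refine LinearMap.ext fun f => Subtype.ext (funext fun x => ?_)
  rw [pullback_apply, pullback_apply, hδ, torusEigenspace_add_apply f.2 hw]

-- In the basis of plane waves γ acts by a monomial matrix, whose diagonal entries are the phases at
-- the frequencies fixed by the linear part.
open scoped Classical in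
theorem trace_pullback (γ : Γ) [Fintype (frequencies (translationLattice Γ) μ)] :
    LinearMap.trace ℂ _ (pullback Γ μ γ) =
      ∑ ξ : frequencies (translationLattice Γ) μ,
        if linearPart n (γ : Isom n) ξ = ξ then planeWave (ξ : Euc n) ((γ : Isom n) 0) else 0 := by
  rw [LinearMap.trace_eq_matrix_trace ℂ (torusEigenbasis Γ μ), Matrix.trace]
  refine Finset.sum_congr rfl fun ξ _ => ?_
  rw [Matrix.diag_apply, LinearMap.toMatrix_apply]
  set η : frequencies (translationLattice Γ) μ :=
    ⟨_, inv_linearPart_mem_frequencies γ.2 ξ.2⟩ with hη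
  have h : pullback Γ μ γ (torusEigenbasis Γ μ ξ) =
      planeWave (ξ : Euc n) ((γ : Isom n) 0) • torusEigenbasis Γ μ η := by
    refine Subtype.ext ?_
    rw [Submodule.coe_smul, torusEigenbasis_apply]
    change (torusEigenbasis Γ μ ξ : Euc n → ℂ) ∘ (γ : Isom n) = _
    rw [torusEigenbasis_apply, planeWave_comp_isom]
  rw [h, map_smul, Finsupp.smul_apply, Basis.repr_self, Finsupp.single_apply, smul_eq_mul]
  have hiff : η = ξ ↔ linearPart n (γ : Isom n) ξ = ξ := by
    rw [Subtype.ext_iff]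
    constructor
    · intro h
      conv_lhs => rw [← h]
      exact (linearPart n (γ : Isom n)).apply_symm_apply _
    · intro h
      change (linearPart n (γ : Isom n)).symm ξ = ξ
      conv_lhs => rw [← h]
      exact (linearPart n (γ : Isom n)).symm_apply_apply _
  simp only [hiff, mul_ite, mul_one, mul_zero]

variable (Γ μ) in
/-- The functions in an eigenspace of the torus that are invariant under `Γ`. -/
def invariants : Submodule ℂ (torusEigenspace Γ μ) where
  carrier := {f | ∀ γ : Γ, pullback Γ μ γ f = f}
  zero_mem' γ := map_zero _
  add_mem' hf hg γ := by rw [map_add, hf γ, hg γ]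
  smul_mem' c f hf γ := by rw [map_smul, hf γ]

/-- The eigenspace of `M` consists of the `Γ`-invariant eigenfunctions on the torus. -/
theorem exists_eigenspace_equiv_invariants (hΓ : IsFlatSpaceGroup Γ) :
    Nonempty (eigenspace Γ μ ≃ₗ[ℂ] invariants Γ μ) := by
  have := hΓ.discrete
  have : IsZLattice ℝ (translationLattice Γ) := ⟨hΓ.span_top⟩
  have hproj : ∀ (γ : Γ) (x : Euc n), proj Γ ((γ : Isom n) x) = proj Γ x := fun γ x =>
    Quotient.sound ((orbitSetoid Γ).symm ⟨γ, γ.2, rfl⟩)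
  have hmem : ∀ f : eigenspace Γ μ, (f : Manifold Γ → ℂ) ∘ proj Γ ∈ torusEigenspace Γ μ := by
    intro f
    refine mem_span_planeWave_of_laplacian_eq f.2.1 (fun v hv x => ?_) f.2.2
    rw [Function.comp_apply, Function.comp_apply, add_comm]
    exact congrArg _ (hproj ⟨_, mem_translationLattice.1 hv⟩ x)
  let T : eigenspace Γ μ →ₗ[ℂ] torusEigenspace Γ μ :=
    { toFun := fun f => ⟨(f : Manifold Γ → ℂ) ∘ proj Γ, hmem f⟩
      map_add' := fun _ _ => rfl
      map_smul' := fun _ _ => rfl }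
  have hT : ∀ f, T f ∈ invariants Γ μ := fun f γ =>
    Subtype.ext (funext fun x => congrArg (f : Manifold Γ → ℂ) (hproj γ x))
  refine ⟨LinearEquiv.ofBijective (T.codRestrict _ hT) ⟨?_, ?_⟩⟩
  · intro f g h
    refine Subtype.ext (funext fun p => ?_)
    obtain ⟨x, rfl⟩ := Quotient.exists_rep p
    exact congrFun (congrArg (fun u : invariants Γ μ => ((u : torusEigenspace Γ μ) : Euc n → ℂ)) h) x
  · rintro ⟨f, hf⟩
    have hinv : ∀ x y, (orbitSetoid Γ).r x y → (f : Euc n → ℂ) x = (f : Euc n → ℂ) y := by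
      rintro x _ ⟨γ, hγ, rfl⟩
      exact (congrFun (congrArg Subtype.val (hf ⟨γ, hγ⟩)) x).symm
    have hf' := contDiff_and_laplacian_of_mem_torusEigenspace f.2
    exact ⟨⟨Quotient.lift (f : Euc n → ℂ) hinv, hf'.1, hf'.2⟩, rfl⟩

theorem finiteDimensional_eigenspace (hΓ : IsFlatSpaceGroup Γ) (μ : ℝ) :
    FiniteDimensional ℂ (eigenspace Γ μ) := by
  have := finiteDimensional_torusEigenspace (μ := μ) hΓ
  obtain ⟨e⟩ := exists_eigenspace_equiv_invariants (μ := μ) hΓ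
  exact Module.Finite.equiv e.symm

theorem trace_eq_finrank_of_isProj {W : Type*} [AddCommGroup W] [Module ℂ W]
    [FiniteDimensional ℂ W] {p : Submodule ℂ W} {f : W →ₗ[ℂ] W} (h : LinearMap.IsProj p f) :
    LinearMap.trace ℂ W f = finrank ℂ p :=
  h.trace

open scoped Classical in
/-- The multiplicities of the Laplace spectrum as character sums over the point group. -/
theorem multiplicity_eq_sum (hΓ : IsFlatSpaceGroup Γ) [Fintype (pointGroup Γ)]
    [Fintype (frequencies (translationLattice Γ) μ)] {r : pointGroup Γ → Isom n}
    (hr : IsRepresentativeSystem Γ r) :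
    (multiplicity Γ μ : ℂ) = (Nat.card (pointGroup Γ) : ℂ)⁻¹ * ∑ M : pointGroup Γ,
      ∑ ξ : frequencies (translationLattice Γ) μ,
        if linearPart n (r M) ξ = ξ then planeWave (ξ : Euc n) (r M 0) else 0 := by
  have := finiteDimensional_torusEigenspace (μ := μ) hΓ
  set A : pointGroup Γ → torusEigenspace Γ μ →ₗ[ℂ] torusEigenspace Γ μ :=
    fun M => pullback Γ μ ⟨r M, (hr M).1⟩ with hA
  set P : torusEigenspace Γ μ →ₗ[ℂ] torusEigenspace Γ μ :=
    (Nat.card (pointGroup Γ) : ℂ)⁻¹ • ∑ M, A M with hP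
  have hcard : (Nat.card (pointGroup Γ) : ℂ) ≠ 0 := by exact_mod_cast Nat.card_pos.ne'
  have hproj : LinearMap.IsProj (invariants Γ μ) P := by
    constructor
    · intro f δ
      let D : pointGroup Γ := ⟨linearPart n (δ : Isom n), mem_pointGroup.2 ⟨δ, δ.2, rfl⟩⟩
      -- Composition with δ permutes the summands of the average, so the average is invariant.
      have h : ∀ M, pullback Γ μ δ (A M f) = A (M * D) f := by
        intro M
        have h1 : A (M * D) = pullback Γ μ (⟨r M, (hr M).1⟩ * δ) := by
          refine pullback_eq_of_linearPart_eq ?_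
          change linearPart n (r (M * D)) = linearPart n (r M * δ)
          rw [(hr _).2, map_mul, (hr M).2]
          rfl
        rw [h1]
        rfl
      simp only [hP, LinearMap.smul_apply, LinearMap.sum_apply, map_smul, map_sum, h]
      congr 1
      exact Equiv.sum_comp (Equiv.mulRight D) fun M => A M f
    · intro f hf
      have h : ∀ M, A M f = f := fun M => hf _
      simp only [hP, LinearMap.smul_apply, LinearMap.sum_apply, h, Finset.sum_const,
        Finset.card_univ, ← Nat.card_eq_fintype_card]
      rw [← Nat.cast_smul_eq_nsmul ℂ, smul_smul, inv_mul_cancel₀ hcard, one_smul]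
  obtain ⟨e⟩ := exists_eigenspace_equiv_invariants (μ := μ) hΓ
  rw [multiplicity, e.finrank_eq, ← trace_eq_finrank_of_isProj hproj, hP, map_smul, map_sum,
    smul_eq_mul]
  simp only [hA, trace_pullback]

end FlatManifold

/-! ### Dirichlet series obtained by grouping terms. -/

namespace LatticeFourier

open Filter Topology

theorem hasSum_tsum_fiber {X E : Type*} [NormedAddCommGroup E] [CompleteSpace E] (φ : X → ℝ)
    {g : X → E} (hg : Summable g) : HasSum (fun l => ∑' x : {x // φ x = l}, g x) (∑' x, g x) :=
  ((Equiv.sigmaFiberEquiv φ).hasSum_iff.2 hg.hasSum).sigma fun _ =>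
    (hg.comp_injective Subtype.val_injective).hasSum

/-- Grouping the terms of `∑ exp (-s φ x)` by the value of `φ`. -/
theorem hasSum_card_fiber_mul_exp {X : Type*} {φ : X → ℝ} {s : ℝ}
    (h : Summable fun x => Real.exp (-s * φ x)) :
    HasSum (fun l => (Nat.card {x // φ x = l} : ℝ) * Real.exp (-s * l))
      (∑' x, Real.exp (-s * φ x)) := by
  have h1 := hasSum_tsum_fiber φ h
  have h2 : (fun l => ∑' x : {x // φ x = l}, Real.exp (-s * φ x)) =
      fun l => (Nat.card {x // φ x = l} : ℝ) * Real.exp (-s * l) := by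
    funext l
    -- An infinite fibre would give zero on both sides by convention, so finiteness of the fibres
    -- need not be shown separately.
    rw [tsum_congr fun x : {x // φ x = l} => by rw [x.2], tsum_const, nsmul_eq_mul]
  rwa [h2] at h1

/-- Coefficients of a Dirichlet series with locally finite exponents that converges absolutely for
positive arguments. -/
structure IsDirichletCoeff (c : ℝ → ℝ) : Prop where
  finite : ∀ R, {l | l ≤ R ∧ c l ≠ 0}.Finite
  summable : ∀ s : ℝ, 0 < s → Summable fun l => c l * Real.exp (-s * l)

namespace IsDirichletCoeff

/-- Local finiteness is automatic: a nonzero natural coefficient is at least 1, so at s = 1 its term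
is at least exp(-R) when l ≤ R, and only finitely many terms of a summable family are that large. -/
theorem of_nat {c : ℝ → ℕ}
    (h : ∀ s : ℝ, 0 < s → Summable fun l => (c l : ℝ) * Real.exp (-s * l)) :
    IsDirichletCoeff fun l => (c l : ℝ) := by
  refine ⟨fun R => ?_, h⟩
  have h1 := (h 1 one_pos).tendsto_cofinite_zero.eventually (gt_mem_nhds (Real.exp_pos (-R)))
  refine Set.Finite.subset h1 ?_
  rintro l ⟨hl, hc⟩ hlt
  change (c l : ℝ) * Real.exp (-1 * l) < Real.exp (-R) at hlt
  have hc' : (1 : ℝ) ≤ c l := by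
    exact_mod_cast Nat.one_le_iff_ne_zero.2 fun h0 => hc (by simp [h0])
  have h2 : Real.exp (-R) ≤ Real.exp (-1 * l) := by
    rw [Real.exp_le_exp]
    linarith
  nlinarith [Real.exp_pos (-1 * l)]

theorem card_fiber {X : Type*} {φ : X → ℝ}
    (h : ∀ s : ℝ, 0 < s → Summable fun x => Real.exp (-s * φ x)) :
    IsDirichletCoeff fun l => (Nat.card {x // φ x = l} : ℝ) :=
  of_nat fun s hs => (hasSum_card_fiber_mul_exp (h s hs)).summable

theorem zero : IsDirichletCoeff 0 :=
  ⟨fun R => by simp, fun s _ => by simp⟩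

theorem add {c c' : ℝ → ℝ} (hc : IsDirichletCoeff c) (hc' : IsDirichletCoeff c') :
    IsDirichletCoeff (c + c') := by
  refine ⟨fun R => ((hc.finite R).union (hc'.finite R)).subset ?_, fun s hs => ?_⟩
  · rintro l ⟨hl, h⟩
    by_cases h0 : c l = 0
    · exact Or.inr ⟨hl, fun h1 => h (by simp [h0, h1])⟩
    · exact Or.inl ⟨hl, h0⟩
  · simpa only [Pi.add_apply, add_mul] using (hc.summable s hs).add (hc'.summable s hs)

theorem const_mul {c : ℝ → ℝ} (hc : IsDirichletCoeff c) (a : ℝ) :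
    IsDirichletCoeff fun l => a * c l := by
  refine ⟨fun R => (hc.finite R).subset ?_, fun s hs => ?_⟩
  · rintro l ⟨hl, h⟩
    exact ⟨hl, right_ne_zero_of_mul h⟩
  · simpa only [mul_assoc] using (hc.summable s hs).mul_left a

theorem sub {c c' : ℝ → ℝ} (hc : IsDirichletCoeff c) (hc' : IsDirichletCoeff c') :
    IsDirichletCoeff fun l => c l - c' l := by
  convert hc.add (hc'.const_mul (-1)) using 1
  funext l
  simp [sub_eq_add_neg]

theorem sum {ι : Type*} (s : Finset ι) {c : ι → ℝ → ℝ} (h : ∀ i ∈ s, IsDirichletCoeff (c i)) :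
    IsDirichletCoeff fun l => ∑ i ∈ s, c i l := by
  classical
  induction s using Finset.induction_on with
  | empty =>
    simp only [Finset.sum_empty]
    exact zero
  | insert i s hi ih =>
    simp only [Finset.sum_insert hi]
    exact (h i (Finset.mem_insert_self i s)).add (ih fun j hj => h j (Finset.mem_insert_of_mem hj))

/-- Uniqueness of the coefficients of a Dirichlet series. -/
theorem eq_of_tsum_eq {c c' : ℝ → ℝ} (hc : IsDirichletCoeff c) (hc' : IsDirichletCoeff c')
    (h : ∀ s : ℝ, 0 < s →
      ∑' l, c l * Real.exp (-s * l) = ∑' l, c' l * Real.exp (-s * l)) : c = c' := by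
  have hd := hc.sub hc'
  funext l
  refine sub_eq_zero.1 (eq_zero_of_sum_rpow_mul_dirichlet_eq_zero (N := 1)
    (c := fun _ l => c l - c' l) (fun _ => hd.finite) (fun _ => hd.summable) (fun s hs => ?_) 0
    one_pos l)
  simp only [Finset.sum_range_one, sub_mul]
  rw [(hc.summable s hs).tsum_sub (hc'.summable s hs), h s hs, sub_self, mul_zero]

end IsDirichletCoeff

end LatticeFourier

/-! ### The heat trace and the d-sums. -/

namespace FlatManifold

open LatticeFourier Module

variable {n : ℕ} {Γ : Subgroup (Isom n)}

theorem summable_exp_neg_mul_inner_shiftedLattice (hΓ : IsFlatSpaceGroup Γ) {γ : Isom n}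
    (hγ : γ ∈ Γ) {a : ℝ} (ha : 0 < a) :
    Summable fun v : shiftedLattice Γ γ => Real.exp (-a * inner ℝ
      (v : fixedSpace (linearPart n γ)) (v : fixedSpace (linearPart n γ))) := by
  have := discreteTopology_projectedLattice hΓ hγ
  rw [← (shiftedLatticeEquiv Γ γ).summable_iff]
  refine (summable_exp_neg_mul_norm_add_sq (projectedLattice Γ γ) ha
    ((fixedSpace (linearPart n γ)).orthogonalProjectionOnto (γ 0))).congr fun u => ?_
  rw [Function.comp_apply, real_inner_self_eq_norm_sq]
  rfl

theorem theta_exp_neg {W : Type*} [NormedAddCommGroup W] [InnerProductSpace ℝ W] (S : Set W)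
    (a : ℝ) : theta S (Real.exp (-a)) = ∑' v : S, Real.exp (-a * inner ℝ (v : W) (v : W)) :=
  tsum_congr fun v => by rw [← Real.exp_mul]

open scoped Classical in
/-- The contribution of `γ` to the heat trace, by Poisson summation in its fixed space. -/
theorem latticeVol_div_mul_theta_eq_tsum (hΓ : IsFlatSpaceGroup Γ) {γ : Isom n} (hγ : γ ∈ Γ)
    {t : ℝ} (ht : 0 < t) :
    ((latticeVol (shiftedLattice Γ γ) / (4 * Real.pi * t) ^ ((fixedDim γ : ℝ) / 2) *
      theta (shiftedLattice Γ γ) (Real.exp (-1 / (4 * t))) : ℝ) : ℂ) =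
    ∑' ξ : dualLattice (translationLattice Γ),
      (if linearPart n γ ξ = ξ then planeWave (ξ : Euc n) (γ 0) else 0) *
        (Real.exp (-t * (4 * Real.pi ^ 2 * ‖(ξ : Euc n)‖ ^ 2)) : ℂ) := by
  have := discreteTopology_projectedLattice hΓ hγ
  have := isZLattice_projectedLattice hΓ hγ
  set π := (fixedSpace (linearPart n γ)).orthogonalProjectionOnto
  -- With this parameter the dual Gaussian is exp(-4π²t‖ξ‖²), that is exp(-μt) for the eigenvalue μ
  -- of the wave.
  have hP := tsum_gaussian_eq_tsum_dualLattice (projectedLattice Γ γ)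
    (a := 1 / (4 * t)) (by positivity) (π (γ 0))
  have h1 : Real.pi / (1 / (4 * t)) = 4 * Real.pi * t := by field_simp
  have h2 : Real.pi ^ 2 / (1 / (4 * t)) = 4 * Real.pi ^ 2 * t := by field_simp
  have htheta : theta (shiftedLattice Γ γ) (Real.exp (-1 / (4 * t))) =
      ∑' u : projectedLattice Γ γ,
        Real.exp (-(1 / (4 * t)) * ‖(u : fixedSpace (linearPart n γ)) + π (γ 0)‖ ^ 2) := by
    rw [neg_div, theta_exp_neg, ← (shiftedLatticeEquiv Γ γ).tsum_eq]
    refine tsum_congr fun u => ?_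
    rw [real_inner_self_eq_norm_sq]
    rfl
  have hvol : latticeVol (shiftedLattice Γ γ) = ZLattice.covolume (projectedLattice Γ γ) := by
    rw [latticeVol, differenceLattice_shiftedLattice]
  rw [← htheta, ← hvol, h1, h2] at hP
  have hpos : 0 < (4 * Real.pi * t) ^ ((fixedDim γ : ℝ) / 2) := by positivity
  have hdual : ∑' ξ : dualLattice (projectedLattice Γ γ),
      planeWave (ξ : fixedSpace (linearPart n γ)) (π (γ 0)) *
        (Real.exp (-(4 * Real.pi ^ 2 * t) * ‖(ξ : fixedSpace (linearPart n γ))‖ ^ 2) : ℂ) =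
      ∑' ξ : dualLattice (translationLattice Γ),
      (if linearPart n γ ξ = ξ then planeWave (ξ : Euc n) (γ 0) else 0) *
        (Real.exp (-t * (4 * Real.pi ^ 2 * ‖(ξ : Euc n)‖ ^ 2)) : ℂ) := by
    let j : dualLattice (projectedLattice Γ γ) → dualLattice (translationLattice Γ) := fun ξ =>
      ⟨((ξ : fixedSpace (linearPart n γ)) : Euc n), mem_dualLattice_projectedLattice.1 ξ.2⟩
    have hj : Function.Injective j := fun ξ η h =>
      Subtype.ext (Subtype.ext (congrArg
        (fun x : dualLattice (translationLattice Γ) => (x : Euc n)) h))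
    -- Terms at frequencies moved by the linear part vanish, so the sum is supported on the image of
    -- `j`.
    rw [← hj.tsum_eq]
    · refine tsum_congr fun ξ => ?_
      have hfix : linearPart n γ (j ξ : Euc n) = (j ξ : Euc n) :=
        mem_fixedSpace.1 (ξ : fixedSpace (linearPart n γ)).2
      rw [if_pos hfix, planeWave_orthogonalProjectionOnto]
      congr 3
      change -(4 * Real.pi ^ 2 * t) * ‖((ξ : fixedSpace (linearPart n γ)) : Euc n)‖ ^ 2 =
        -t * (4 * Real.pi ^ 2 * ‖((ξ : fixedSpace (linearPart n γ)) : Euc n)‖ ^ 2)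
      ring
    · intro ξ hξ
      have hfix : linearPart n γ (ξ : Euc n) = (ξ : Euc n) := by
        by_contra h
        exact hξ (by simp [h])
      exact ⟨⟨⟨ξ, mem_fixedSpace.2 hfix⟩, mem_dualLattice_projectedLattice.2 ξ.2⟩, rfl⟩
  rw [← hdual]
  have hpos' : (((4 * Real.pi * t) ^ ((fixedDim γ : ℝ) / 2) : ℝ) : ℂ) ≠ 0 := by
    exact_mod_cast hpos.ne'
  rw [div_mul_eq_mul_div, Complex.ofReal_div, div_eq_iff hpos', hP, mul_comm]
  rfl

theorem summable_exp_dualLattice (hΓ : IsFlatSpaceGroup Γ) {t : ℝ} (ht : 0 < t) :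
    Summable fun ξ : dualLattice (translationLattice Γ) =>
      Real.exp (-t * (4 * Real.pi ^ 2 * ‖(ξ : Euc n)‖ ^ 2)) := by
  have := hΓ.discrete
  have : IsZLattice ℝ (translationLattice Γ) := ⟨hΓ.span_top⟩
  refine (summable_exp_neg_mul_norm_add_sq (dualLattice (translationLattice Γ))
    (a := 4 * Real.pi ^ 2 * t) (by positivity) 0).congr fun ξ => ?_
  rw [add_zero]
  ring_nf

/-- **The heat trace formula.** -/
theorem hasSum_multiplicity_mul_exp (hΓ : IsFlatSpaceGroup Γ) {r : pointGroup Γ → Isom n}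
    (hr : IsRepresentativeSystem Γ r) {t : ℝ} (ht : 0 < t) :
    HasSum (fun μ : ℝ => (multiplicity Γ μ : ℝ) * Real.exp (-μ * t))
      (1 / (Nat.card (pointGroup Γ) : ℝ) * ∑ᶠ M : pointGroup Γ,
        latticeVol (shiftedLattice Γ (r M)) / (4 * Real.pi * t) ^ ((fixedDim (r M) : ℝ) / 2) *
          theta (shiftedLattice Γ (r M)) (Real.exp (-1 / (4 * t)))) := by
  classical
  have := hΓ.discrete
  have : IsZLattice ℝ (translationLattice Γ) := ⟨hΓ.span_top⟩
  have := finite_pointGroup hΓ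
  have := Fintype.ofFinite (pointGroup Γ)
  have hfin : ∀ μ, Fintype (frequencies (translationLattice Γ) μ) := fun μ =>
    (finite_frequencies (translationLattice Γ) μ).fintype
  rw [finsum_eq_sum_of_fintype, ← Complex.hasSum_ofReal]
  set a : pointGroup Γ → Euc n → ℂ := fun M ξ =>
    if linearPart n (r M) ξ = ξ then planeWave ξ (r M 0) else 0
  set φ : dualLattice (translationLattice Γ) → ℝ := fun ξ => 4 * Real.pi ^ 2 * ‖(ξ : Euc n)‖ ^ 2
  have hsum : ∀ M, Summable fun ξ : dualLattice (translationLattice Γ) =>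
      a M ξ * (Real.exp (-t * φ ξ) : ℂ) := fun M => by
    refine Summable.of_norm_bounded (summable_exp_dualLattice hΓ ht) fun ξ => ?_
    rw [norm_mul, Complex.norm_real, Real.norm_eq_abs, Real.abs_exp]
    refine mul_le_of_le_one_left (Real.exp_pos _).le ?_
    simp only [a]
    split_ifs <;> simp
  have hM : ∀ M, HasSum (fun μ => (∑ ξ : frequencies (translationLattice Γ) μ, a M ξ) *
      (Real.exp (-t * μ) : ℂ)) (∑' ξ : dualLattice (translationLattice Γ),
        a M ξ * (Real.exp (-t * φ ξ) : ℂ)) := by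
    intro M
    have h1 := hasSum_tsum_fiber φ (hsum M)
    refine HasSum.congr_fun h1 fun μ => ?_
    let e : frequencies (translationLattice Γ) μ ≃ {ξ // φ ξ = μ} :=
      { toFun := fun ξ => ⟨⟨ξ, ξ.2.1⟩, ξ.2.2⟩
        invFun := fun ξ => ⟨ξ, ξ.1.2, ξ.2⟩
        left_inv := fun _ => rfl
        right_inv := fun _ => rfl }
    rw [← e.tsum_eq, tsum_fintype, Finset.sum_mul]
    refine Finset.sum_congr rfl fun ξ _ => ?_
    rw [(e ξ).2]
    rfl
  have h := (hasSum_sum fun M (_ : M ∈ Finset.univ) => hM M).mul_left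
    (Nat.card (pointGroup Γ) : ℂ)⁻¹
  have hval : ((1 / (Nat.card (pointGroup Γ) : ℝ) * ∑ M : pointGroup Γ,
      latticeVol (shiftedLattice Γ (r M)) / (4 * Real.pi * t) ^ ((fixedDim (r M) : ℝ) / 2) *
        theta (shiftedLattice Γ (r M)) (Real.exp (-1 / (4 * t))) : ℝ) : ℂ) =
      (Nat.card (pointGroup Γ) : ℂ)⁻¹ * ∑ M, ∑' ξ : dualLattice (translationLattice Γ),
        a M ξ * (Real.exp (-t * φ ξ) : ℂ) := by
    rw [Complex.ofReal_mul, Complex.ofReal_sum, one_div, Complex.ofReal_inv, Complex.ofReal_natCast]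
    congr 1
    exact Finset.sum_congr rfl fun M _ => latticeVol_div_mul_theta_eq_tsum hΓ (hr M).1 ht
  rw [hval]
  refine HasSum.congr_fun h fun μ => ?_
  rw [Complex.ofReal_mul, Complex.ofReal_natCast, multiplicity_eq_sum hΓ hr, mul_assoc,
    Finset.sum_mul, neg_mul, neg_mul, mul_comm μ t]

variable {r : pointGroup Γ → Isom n}

theorem dSum_eq_sum (Γ : Subgroup (Isom n)) (r : pointGroup Γ → Isom n)
    [Fintype (pointGroup Γ)] (d : ℕ) (q : ℝ) :
    dSum Γ r d q = ∑ M : pointGroup Γ, if fixedDim (r M) = d then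
      latticeVol (shiftedLattice Γ (r M)) * theta (shiftedLattice Γ (r M)) q else 0 := by
  rw [dSum, finsum_eq_sum_of_fintype]
  exact Finset.sum_congr rfl fun M _ => finsum_eq_if

theorem fixedDim_le (γ : Isom n) : fixedDim γ ≤ n :=
  (fixedSpace (linearPart n γ)).finrank_le.trans_eq finrank_euclideanSpace_fin

theorem dSum_eq_zero_of_lt (hΓ : IsFlatSpaceGroup Γ) {d : ℕ} (hd : n < d) (q : ℝ) :
    dSum Γ r d q = 0 := by
  have := finite_pointGroup hΓ
  have := Fintype.ofFinite (pointGroup Γ)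
  rw [dSum_eq_sum]
  exact Finset.sum_eq_zero fun M _ => if_neg ((fixedDim_le _).trans_lt hd).ne

/-- The `d`-sums are Dirichlet series in `s`, where `q = exp (-s)`. -/
theorem exists_dSum_exp_neg_eq_tsum (hΓ : IsFlatSpaceGroup Γ) (hr : IsRepresentativeSystem Γ r) :
    ∃ C : ℕ → ℝ → ℝ, (∀ d, IsDirichletCoeff (C d)) ∧ ∀ d, ∀ s : ℝ, 0 < s →
      dSum Γ r d (Real.exp (-s)) = ∑' l, C d l * Real.exp (-s * l) := by
  have := finite_pointGroup hΓ
  have := Fintype.ofFinite (pointGroup Γ)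
  let φ : ∀ M : pointGroup Γ, shiftedLattice Γ (r M) → ℝ := fun M v => inner ℝ
    (v : fixedSpace (linearPart n (r M))) (v : fixedSpace (linearPart n (r M)))
  have hφ : ∀ M, ∀ s : ℝ, 0 < s → Summable fun v => Real.exp (-s * φ M v) := fun M s hs =>
    summable_exp_neg_mul_inner_shiftedLattice hΓ (hr M).1 hs
  have hterm : ∀ (d : ℕ) (M : pointGroup Γ), IsDirichletCoeff fun l =>
      (if fixedDim (r M) = d then latticeVol (shiftedLattice Γ (r M)) else 0) *
        (Nat.card {v // φ M v = l} : ℝ) := fun d M =>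
    (IsDirichletCoeff.card_fiber (hφ M)).const_mul _
  refine ⟨fun d l => ∑ M : pointGroup Γ,
    (if fixedDim (r M) = d then latticeVol (shiftedLattice Γ (r M)) else 0) *
      (Nat.card {v // φ M v = l} : ℝ),
    fun d => IsDirichletCoeff.sum _ fun M _ => hterm d M, fun d s hs => ?_⟩
  simp only [Finset.sum_mul]
  rw [dSum_eq_sum, Summable.tsum_finsetSum fun M _ => (hterm d M).summable s hs]
  refine Finset.sum_congr rfl fun M _ => ?_
  simp only [mul_assoc]
  rw [tsum_mul_left, (hasSum_card_fiber_mul_exp (hφ M s hs)).tsum_eq, theta_exp_neg, ite_mul,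
    zero_mul]

/-- The heat trace in terms of the `d`-sums. -/
theorem tsum_multiplicity_mul_exp_eq_sum_dSum (hΓ : IsFlatSpaceGroup Γ)
    (hr : IsRepresentativeSystem Γ r) {t : ℝ} (ht : 0 < t) {N : ℕ} (hN : n < N) :
    ∑' μ : ℝ, (multiplicity Γ μ : ℝ) * Real.exp (-μ * t) =
      (Nat.card (pointGroup Γ) : ℝ)⁻¹ * ∑ d ∈ Finset.range N,
        dSum Γ r d (Real.exp (-1 / (4 * t))) / (4 * Real.pi * t) ^ ((d : ℝ) / 2) := by
  have := finite_pointGroup hΓ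
  have := Fintype.ofFinite (pointGroup Γ)
  rw [(hasSum_multiplicity_mul_exp hΓ hr ht).tsum_eq, one_div, finsum_eq_sum_of_fintype]
  congr 1
  simp only [dSum_eq_sum, Finset.sum_div]
  rw [Finset.sum_comm]
  refine Finset.sum_congr rfl fun M _ => ?_
  rw [Finset.sum_eq_single (fixedDim (r M))]
  · rw [if_pos rfl]
    ring
  · intro d _ hd
    rw [if_neg hd.symm, zero_div]
  · intro h
    exact absurd (Finset.mem_range.2 ((fixedDim_le _).trans_lt hN)) h

/-- This isolates the identity as the sole contributor to the n-sum. -/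
theorem fixedDim_eq_iff (hr : IsRepresentativeSystem Γ r) (M : pointGroup Γ) :
    fixedDim (r M) = n ↔ M = 1 := by
  have h1 : fixedDim (r M) = n ↔ fixedSpace (linearPart n (r M)) = ⊤ := by
    refine ⟨fun h => Submodule.eq_top_of_finrank_eq (h.trans finrank_euclideanSpace_fin.symm),
      fun h => ?_⟩
    rw [fixedDim, h, finrank_top, finrank_euclideanSpace_fin]
  rw [h1, (hr M).2, Submodule.eq_top_iff']
  constructor
  · intro h
    exact Subtype.ext (LinearIsometryEquiv.ext h)
  · rintro rfl v
    rfl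

/-- The top-dimensional `d`-sum in terms of the dual lattice. -/
theorem dSum_self_div_eq_tsum (hΓ : IsFlatSpaceGroup Γ) (hr : IsRepresentativeSystem Γ r)
    {t : ℝ} (ht : 0 < t) :
    dSum Γ r n (Real.exp (-1 / (4 * t))) / (4 * Real.pi * t) ^ ((n : ℝ) / 2) =
      ∑' ξ : dualLattice (translationLattice Γ),
        Real.exp (-t * (4 * Real.pi ^ 2 * ‖(ξ : Euc n)‖ ^ 2)) := by
  classical
  have := finite_pointGroup hΓ
  have := Fintype.ofFinite (pointGroup Γ)
  have hlin : linearPart n (r 1) = 1 := (hr 1).2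
  obtain ⟨w, hw, h0⟩ := exists_mem_translationLattice_of_linearPart_eq Γ.one_mem (hr 1).1
    (show linearPart n 1 = linearPart n (r 1) by rw [hlin, map_one])
  -- The chosen representative of the identity may be any lattice translation; its phases at dual
  -- lattice vectors are all 1.
  have hr0 : r 1 0 ∈ translationLattice Γ := by
    have : r 1 0 = w := (h0 0).trans (zero_add w)
    rwa [this]
  have h := latticeVol_div_mul_theta_eq_tsum hΓ (hr 1).1 ht
  have hterm : ∀ ξ : dualLattice (translationLattice Γ),
      (if linearPart n (r 1) ξ = ξ then planeWave (ξ : Euc n) (r 1 0) else 0) = 1 := fun ξ => by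
    rw [if_pos (by rw [hlin]; rfl), planeWave_eq_one ξ.2 hr0]
  simp only [hterm, one_mul] at h
  rw [← Complex.ofReal_tsum, Complex.ofReal_inj] at h
  rw [← h, dSum_eq_sum]
  simp only [fixedDim_eq_iff hr, Finset.sum_ite_eq', Finset.mem_univ, if_true]
  rw [(fixedDim_eq_iff hr 1).2 rfl]
  ring

theorem isDirichletCoeff_multiplicity (hΓ : IsFlatSpaceGroup Γ) (hr : IsRepresentativeSystem Γ r) :
    IsDirichletCoeff fun μ => (multiplicity Γ μ : ℝ) :=
  IsDirichletCoeff.of_nat fun _ hs =>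
    (hasSum_multiplicity_mul_exp hΓ hr hs).summable.congr fun μ => by
      rw [neg_mul, neg_mul, mul_comm μ]

/-- The constant term of the theta series of 𝒯* is the same for every lattice, so it can serve to
read off the factor |G|⁻¹. -/
theorem card_zero_fiber_dualLattice (Γ : Subgroup (Isom n)) :
    Nat.card {ξ : dualLattice (translationLattice Γ) //
      4 * Real.pi ^ 2 * ‖(ξ : Euc n)‖ ^ 2 = 0} = 1 := by
  rw [Nat.card_eq_one_iff_unique]
  have h : ∀ ξ : dualLattice (translationLattice Γ),
      4 * Real.pi ^ 2 * ‖(ξ : Euc n)‖ ^ 2 = 0 → ξ = 0 := by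
    intro ξ hξ
    have : 4 * Real.pi ^ 2 ≠ 0 := by positivity
    simpa [this] using hξ
  exact ⟨⟨fun x y => Subtype.ext ((h _ x.2).trans (h _ y.2).symm)⟩, ⟨⟨0, by simp⟩⟩⟩

/-! ### What the spectrum determines. -/

section Audible

variable {m : ℕ} {Γ' : Subgroup (Isom m)} {r' : pointGroup Γ' → Isom m}

/-- Isospectral manifolds have the same normalized `d`-sums. -/
theorem Isospectral.dSum_div_card_eq (h : Isospectral Γ Γ') (hΓ : IsFlatSpaceGroup Γ)
    (hr : IsRepresentativeSystem Γ r) (hΓ' : IsFlatSpaceGroup Γ')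
    (hr' : IsRepresentativeSystem Γ' r') (d : ℕ) {s : ℝ} (hs : 0 < s) :
    (Nat.card (pointGroup Γ) : ℝ)⁻¹ * dSum Γ r d (Real.exp (-s)) =
      (Nat.card (pointGroup Γ') : ℝ)⁻¹ * dSum Γ' r' d (Real.exp (-s)) := by
  obtain ⟨C, hC, hCs⟩ := exists_dSum_exp_neg_eq_tsum hΓ hr
  obtain ⟨C', hC', hCs'⟩ := exists_dSum_exp_neg_eq_tsum hΓ' hr'
  set a : ℝ := (Nat.card (pointGroup Γ) : ℝ)⁻¹
  set a' : ℝ := (Nat.card (pointGroup Γ') : ℝ)⁻¹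
  -- The range must contain every d with a nonzero d-sum on either side, as well as the given d.
  set N := max n m + 1 + d
  let c : ℕ → ℝ → ℝ := fun d l => Real.pi ^ (-((d : ℝ) / 2)) * (a * C d l - a' * C' d l)
  have hc : ∀ d, IsDirichletCoeff (c d) := fun d =>
    (((hC d).const_mul a).sub ((hC' d).const_mul a')).const_mul _
  have hcs : ∀ d, ∀ s : ℝ, 0 < s → ∑' l, c d l * Real.exp (-s * l) =
      Real.pi ^ (-((d : ℝ) / 2)) *
        (a * dSum Γ r d (Real.exp (-s)) - a' * dSum Γ' r' d (Real.exp (-s))) := by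
    intro d s hs
    rw [hCs d s hs, hCs' d s hs, ← tsum_mul_left, ← tsum_mul_left,
      ← Summable.tsum_sub (((hC d).summable s hs).mul_left a)
        (((hC' d).summable s hs).mul_left a'), ← tsum_mul_left]
    refine tsum_congr fun l => ?_
    simp only [c]
    ring
  have hzero := eq_zero_of_sum_rpow_mul_dirichlet_eq_zero (N := N) (c := c)
    (fun d => (hc d).finite) (fun d => (hc d).summable) (fun s hs => ?_) d
    (by simp only [N]; omega)
  · have h1 := hcs d s hs
    simp only [hzero, zero_mul, tsum_zero] at h1
    have hpi : Real.pi ^ (-((d : ℝ) / 2)) ≠ 0 := (Real.rpow_pos_of_pos Real.pi_pos _).ne'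
    exact sub_eq_zero.1 ((mul_eq_zero.1 h1.symm).resolve_left hpi)
  -- At t = 1/(4s) the nome is exp(-s) and 4πt = π/s, which explains the powers of π in `c`.
  · have ht : 0 < 1 / (4 * s) := by positivity
    have h1 := tsum_multiplicity_mul_exp_eq_sum_dSum hΓ hr ht (N := N) (by simp only [N]; omega)
    have h2 := tsum_multiplicity_mul_exp_eq_sum_dSum hΓ' hr' ht (N := N) (by simp only [N]; omega)
    simp only [h _, h2] at h1
    have e1 : -1 / (4 * (1 / (4 * s))) = -s := by field_simp
    have e2 : 4 * Real.pi * (1 / (4 * s)) = Real.pi / s := by field_simp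
    rw [e1, e2, ← sub_eq_zero, Finset.mul_sum, Finset.mul_sum, ← Finset.sum_sub_distrib] at h1
    -- In `h1` the difference is taken in the order opposite to that in `c`.
    rw [← neg_eq_zero, ← Finset.sum_neg_distrib]
    refine (Finset.sum_congr rfl fun d _ => ?_).trans h1
    rw [hcs d s hs, Real.div_rpow Real.pi_pos.le hs.le, Real.rpow_neg Real.pi_pos.le]
    have hp1 : 0 < Real.pi ^ ((d : ℝ) / 2) := Real.rpow_pos_of_pos Real.pi_pos _
    have hp2 : 0 < s ^ ((d : ℝ) / 2) := Real.rpow_pos_of_pos hs _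
    field_simp
    ring

/-- If m < n, no element for Γ' has an n-dimensional fixed space, so its n-sum vanishes, whereas
that of Γ is a positive multiple of a sum of positive Gaussians. -/
theorem Isospectral.dim_le (h : Isospectral Γ Γ') (hΓ : IsFlatSpaceGroup Γ)
    (hr : IsRepresentativeSystem Γ r) (hΓ' : IsFlatSpaceGroup Γ')
    (hr' : IsRepresentativeSystem Γ' r') : n ≤ m := by
  by_contra! hlt
  have := finite_pointGroup hΓ
  have h1 := h.dSum_div_card_eq hΓ hr hΓ' hr' n (s := 1 / 4) (by norm_num)
  have hcard : (Nat.card (pointGroup Γ) : ℝ)⁻¹ ≠ 0 :=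
    inv_ne_zero (Nat.cast_ne_zero.2 Nat.card_pos.ne')
  rw [dSum_eq_zero_of_lt hΓ' hlt, mul_zero] at h1
  have h2 := (mul_eq_zero.1 h1).resolve_left hcard
  have h3 := dSum_self_div_eq_tsum hΓ hr one_pos
  rw [show (-1 / (4 * 1) : ℝ) = -(1 / 4) by norm_num, h2, zero_div] at h3
  have h4 := (summable_exp_dualLattice hΓ one_pos).tsum_pos (fun ξ => (Real.exp_pos _).le) 0
    (Real.exp_pos _)
  exact h4.ne h3

theorem Isospectral.symm (h : Isospectral Γ Γ') : Isospectral Γ' Γ := fun μ => (h μ).symm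

/-- Isospectral manifolds have point groups of the same order. -/
theorem Isospectral.card_pointGroup_eq (h : Isospectral Γ Γ') (hΓ : IsFlatSpaceGroup Γ)
    (hr : IsRepresentativeSystem Γ r) (hΓ' : IsFlatSpaceGroup Γ')
    (hr' : IsRepresentativeSystem Γ' r') :
    Nat.card (pointGroup Γ) = Nat.card (pointGroup Γ') := by
  obtain rfl : n = m := le_antisymm (h.dim_le hΓ hr hΓ' hr') (h.symm.dim_le hΓ' hr' hΓ hr)
  have hZ : ∀ Δ : Subgroup (Isom n), IsFlatSpaceGroup Δ → IsDirichletCoeff fun l =>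
      (Nat.card {ξ : dualLattice (translationLattice Δ) //
        4 * Real.pi ^ 2 * ‖(ξ : Euc n)‖ ^ 2 = l} : ℝ) := fun Δ hΔ =>
    IsDirichletCoeff.card_fiber fun t ht => summable_exp_dualLattice hΔ ht
  -- The equality of normalized n-sums, read through Poisson summation, identifies the theta series
  -- of the two dual lattices up to the factors |G|⁻¹; the coefficient at exponent 0 then compares
  -- these factors.
  have heq := IsDirichletCoeff.eq_of_tsum_eq
    ((hZ Γ hΓ).const_mul (Nat.card (pointGroup Γ) : ℝ)⁻¹)
    ((hZ Γ' hΓ').const_mul (Nat.card (pointGroup Γ') : ℝ)⁻¹) fun t ht => by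
      simp only [mul_assoc (Nat.card (pointGroup Γ) : ℝ)⁻¹,
        mul_assoc (Nat.card (pointGroup Γ') : ℝ)⁻¹]
      rw [tsum_mul_left, tsum_mul_left,
        (hasSum_card_fiber_mul_exp (summable_exp_dualLattice hΓ ht)).tsum_eq,
        (hasSum_card_fiber_mul_exp (summable_exp_dualLattice hΓ' ht)).tsum_eq,
        ← dSum_self_div_eq_tsum hΓ hr ht, ← dSum_self_div_eq_tsum hΓ' hr' ht, ← mul_div_assoc,
        ← mul_div_assoc, neg_div, h.dSum_div_card_eq hΓ hr hΓ' hr' n (by positivity)]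
  have h0 := congrFun heq 0
  simp only [card_zero_fiber_dualLattice, Nat.cast_one, mul_one] at h0
  exact_mod_cast inv_injective h0

/-- The spectrum determines, and is determined by, the order of the point group and the
`d`-sums. -/
theorem isospectral_iff (hΓ : IsFlatSpaceGroup Γ) (hr : IsRepresentativeSystem Γ r)
    (hΓ' : IsFlatSpaceGroup Γ') (hr' : IsRepresentativeSystem Γ' r') :
    Isospectral Γ Γ' ↔ Nat.card (pointGroup Γ) = Nat.card (pointGroup Γ') ∧
      ∀ d : ℕ, ∀ q ∈ Set.Ioo (0 : ℝ) 1, dSum Γ r d q = dSum Γ' r' d q := by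
  constructor
  · intro h
    have hcard := h.card_pointGroup_eq hΓ hr hΓ' hr'
    refine ⟨hcard, fun d q hq => ?_⟩
    have h1 := h.dSum_div_card_eq hΓ hr hΓ' hr' d (neg_pos.2 (Real.log_neg hq.1 hq.2))
    rw [neg_neg, Real.exp_log hq.1, hcard] at h1
    have := finite_pointGroup hΓ'
    have hne : (Nat.card (pointGroup Γ') : ℝ)⁻¹ ≠ 0 :=
      inv_ne_zero (Nat.cast_ne_zero.2 Nat.card_pos.ne')
    exact mul_left_cancel₀ hne h1
  · rintro ⟨hcard, hd⟩
    -- The heat traces agree for all t, and as Dirichlet series in t with exponents μ they determine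
    -- the multiplicities.
    have heq := IsDirichletCoeff.eq_of_tsum_eq (isDirichletCoeff_multiplicity hΓ hr)
      (isDirichletCoeff_multiplicity hΓ' hr') fun t ht => by
        have h1 := tsum_multiplicity_mul_exp_eq_sum_dSum hΓ hr ht (N := max n m + 1) (by omega)
        have h2 := tsum_multiplicity_mul_exp_eq_sum_dSum hΓ' hr' ht (N := max n m + 1) (by omega)
        have hq : Real.exp (-1 / (4 * t)) ∈ Set.Ioo (0 : ℝ) 1 :=
          ⟨Real.exp_pos _, Real.exp_lt_one_iff.2 (div_neg_of_neg_of_pos (by norm_num)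
            (by positivity))⟩
        have hcomm : ∀ μ : ℝ, -t * μ = -μ * t := fun μ => by ring
        simp only [hcomm]
        rw [h1, h2, hcard]
        simp only [hd _ _ hq]
    intro μ
    exact_mod_cast congrFun heq μ

end Audible

end FlatManifold

end

theorem mainTheorem5 {n : ℕ}
    (Γ : Subgroup (FlatManifold.Isom n)) (hΓ : FlatManifold.IsFlatSpaceGroup Γ)
    (r : FlatManifold.pointGroup Γ → FlatManifold.Isom n)
    (hr : FlatManifold.IsRepresentativeSystem Γ r) :
    -- the point group is finite and the Laplace eigenvalues have finite multiplicity
    Finite (FlatManifold.pointGroup Γ) ∧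
    (∀ μ : ℝ, FiniteDimensional ℂ (FlatManifold.eigenspace Γ μ)) ∧
    -- the theta series converge
    (∀ γ ∈ Γ, ∀ q ∈ Set.Ioo (0 : ℝ) 1,
      Summable fun v : FlatManifold.shiftedLattice Γ γ =>
        q ^ (inner ℝ (v : FlatManifold.fixedSpace (FlatManifold.linearPart n γ))
          (v : FlatManifold.fixedSpace (FlatManifold.linearPart n γ)))) ∧
    -- the heat trace formula
    (∀ t : ℝ, 0 < t →
      HasSum (fun μ : ℝ => (FlatManifold.multiplicity Γ μ : ℝ) * Real.exp (-μ * t))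
        (1 / (Nat.card (FlatManifold.pointGroup Γ) : ℝ) *
          ∑ᶠ M : FlatManifold.pointGroup Γ,
            FlatManifold.latticeVol (FlatManifold.shiftedLattice Γ (r M)) /
                (4 * Real.pi * t) ^ ((FlatManifold.fixedDim (r M) : ℝ) / 2) *
              FlatManifold.theta (FlatManifold.shiftedLattice Γ (r M))
                (Real.exp (-1 / (4 * t))))) ∧
    -- the spectrum determines, and is determined by, the order of the point group and the d-sums
    (∀ (m : ℕ) (Γ' : Subgroup (FlatManifold.Isom m))
      (r' : FlatManifold.pointGroup Γ' → FlatManifold.Isom m),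
      FlatManifold.IsFlatSpaceGroup Γ' → FlatManifold.IsRepresentativeSystem Γ' r' →
      (FlatManifold.Isospectral Γ Γ' ↔
        Nat.card (FlatManifold.pointGroup Γ) = Nat.card (FlatManifold.pointGroup Γ') ∧
        ∀ d : ℕ, ∀ q ∈ Set.Ioo (0 : ℝ) 1,
          FlatManifold.dSum Γ r d q = FlatManifold.dSum Γ' r' d q)) := by
  refine ⟨FlatManifold.finite_pointGroup hΓ, FlatManifold.finiteDimensional_eigenspace hΓ,
    fun γ hγ q hq => ?_, fun t ht => FlatManifold.hasSum_multiplicity_mul_exp hΓ hr ht,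
    fun m Γ' r' hΓ' hr' => FlatManifold.isospectral_iff hΓ hr hΓ' hr'⟩
  have h := FlatManifold.summable_exp_neg_mul_inner_shiftedLattice hΓ hγ
    (neg_pos.2 (Real.log_neg hq.1 hq.2))
  refine h.congr fun v => ?_
  rw [neg_neg, Real.rpow_def_of_pos hq.1]
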